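/- Let $d,n\ge 1$, let $\tilde a\in\mathbf R^{d\times n}$, $\tilde b\in\mathbf R^n$, put $f_j(a,b,x)=\sum_{i=1}^d a_{ij}x_i+b_j$ and let $P=\{x\in\mathbf R^d: f_j(\tilde a,\tilde b,x)\ge 0,\ 1\le j\le n\}$. A face of $P$ is a set $P\cap\{x:\sum_i c_ix_i+c_0=0\}$ where $\sum_i c_ix_i+c_0\ge 0$ holds on $P$; its dimension is that of its affine hull ($-1$ for $\emptyset$), and a facet is a face of dimension $\dim P-1$. Suppose that the sets $F_j=P\cap\{x:f_j(\tilde a,\tilde b,x)=0\}$, $1\le j\le n$, are all the facets of $P$, each listed once, and that $P$ is in general position: with $\ell_0(x)=x_0$ and $\ell_j(x)=\tilde b_jx_0+\sum_i\tilde a_{ij}x_i$ on $\mathbf R^{d+1}$, for every $J\subset\{0,\dots,n\}$ the cone $\{x:\ell_j(x)=0\ (j\in J),\ \ell_j(x)\ge 0\ (0\le j\le n)\}$ has dimension $d+1-|J|$ or equals $\{0\}$. Let $\mathcal F$ be the set of all $J\subset\{1,\dots,n\}$ with $P\cap\bigcap_{j\in J}F_j\ne\emptyset$. For $F\in\mathcal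 F$ and real $(a,b)$ let $$\varphi_F(a,b)=\int_{\mathbf R^d}\frac{1}{(2\pi)^{d/2}}\exp\Bigl(-\frac12\sum_{i=1}^d x_i^2\Bigr)\prod_{j\in F}\bigl(H(f_j(a,b,x))-1\bigr)\,dx,$$ where $H$ is the Heaviside function, and let $\alpha_F(a)=\bigl(\sum_{k}a_{ki}a_{kj}\bigr)_{i,j\in F}$. Let $D$ be the ring of differential operators with coefficients in $\mathbf C[a_{ij},b_j]$, and let $M=D^{\mathcal F}/N$, where $D^{\mathcal F}$ has the basis $g^J$ $(J\in\mathcal F)$, $g^J:=0$ for $J\notin\mathcal F$, and $N$ is the left submodule generated by $$\Bigl(\partial_{a_{ij}}-\sum_{k=1}^n a_{ik}\partial_{b_k}\partial_{b_j}\Bigr)g^J\ (1\le i\le d,\ 1\le j\le n),\qquad \partial_{b_j}g^J-g^{J\cup\{j\}}\ (j\notin J),\qquad \Bigl(b_j+\sum_{k=1}^n\sum_{i=1}^d a_{ij}a_{ik}\partial_{b_k}\Bigr)g^J\ (j\in J)$$ for $J\in\mathcal F$. A family $(h^J)_{J\in\mathcal F}$ of holomorphic functions on an open set $\Omega$ is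 a solution of $M$ if there is a morphism of left $D$-modules $M\to\mathcal O(\Omega)$ that maps the class of $g^J$ to $h^J$ for all $J$; the holonomic rank of $M$ is $\dim_{\mathbf C(a,b)}\mathbf C(a,b)\otimes_{\mathbf C[a,b]}M$. Then the functions $\varphi_F$, $F\in\mathcal F$, are linearly independent real analytic solutions of $M$. Precisely: (1) for $F\in\mathcal F$, $\det\alpha_F(\tilde a)\ne 0$, and $\varphi_F$ is real analytic on $\{(a,b)\in\mathbf R^{d\times n}\times\mathbf R^n:\det\alpha_F(a)\ne 0\}$; (2) on every neighbourhood of $(\tilde a,\tilde b)$ in $\mathbf R^{d\times n}\times\mathbf R^n$ the functions $\varphi_F$ $(F\in\mathcal F)$ are linearly independent over $\mathbf C$; (3) there is a connected open neighbourhood $U\subset\mathbf C^{d\times n}$ of $\tilde a$ and there are holomorphic functions $\Phi_F$ $(F\in\mathcal F)$ on $U\times\mathbf C^n$, linearly independent over $\mathbf C$, such that $\Phi_F=\varphi_F$ at the real points of $U\times\mathbf C^n$ and $\bigl(\prod_{j\in J}\partial_{b_j}\Phi_F\bigr)_{J\in\mathcal F}$ is a solution of $M$. Consequently (4) the holonomic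 rank of $M$ is finite and not less than the number of nonempty faces of $P$ (including $P$ itself). -/

import Mathlib

open scoped TensorProduct Topology

noncomputable section

/-! ### The Weyl algebra, its modules and the holonomic rank -/

/-- The defining relations of the Weyl algebra in the variables `σ`: the generator `Sum.inl i` is
the variable `x_i`, the generator `Sum.inr i` is the derivation `∂_i`. -/
inductive WeylRel (σ : Type) : FreeAlgebra ℂ (σ ⊕ σ) → FreeAlgebra ℂ (σ ⊕ σ) → Prop
  | xx (i j : σ) : WeylRel σ
      (FreeAlgebra.ι ℂ (Sum.inl i) * FreeAlgebra.ι ℂ (Sum.inl j))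
      (FreeAlgebra.ι ℂ (Sum.inl j) * FreeAlgebra.ι ℂ (Sum.inl i))
  | dd (i j : σ) : WeylRel σ
      (FreeAlgebra.ι ℂ (Sum.inr i) * FreeAlgebra.ι ℂ (Sum.inr j))
      (FreeAlgebra.ι ℂ (Sum.inr j) * FreeAlgebra.ι ℂ (Sum.inr i))
  | dx_ne (i j : σ) (h : i ≠ j) : WeylRel σ
      (FreeAlgebra.ι ℂ (Sum.inr i) * FreeAlgebra.ι ℂ (Sum.inl j))
      (FreeAlgebra.ι ℂ (Sum.inl j) * FreeAlgebra.ι ℂ (Sum.inr i))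
  | dx_self (i : σ) : WeylRel σ
      (FreeAlgebra.ι ℂ (Sum.inr i) * FreeAlgebra.ι ℂ (Sum.inl i))
      (FreeAlgebra.ι ℂ (Sum.inl i) * FreeAlgebra.ι ℂ (Sum.inr i) + 1)

/-- The Weyl algebra `ℂ⟨x_i, ∂_i : i ∈ σ⟩`, the ring of differential operators with polynomial
coefficients in the variables `σ`. -/
def WeylAlgebra (σ : Type) : Type := RingQuot (WeylRel σ)

namespace WeylAlgebra

instance (σ : Type) : Ring (WeylAlgebra σ) := inferInstanceAs (Ring (RingQuot (WeylRel σ)))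

instance (σ : Type) : Algebra ℂ (WeylAlgebra σ) :=
  inferInstanceAs (Algebra ℂ (RingQuot (WeylRel σ)))

variable {σ : Type}

/-- The variable `x_i`, as a differential operator of order zero. -/
def X (i : σ) : WeylAlgebra σ :=
  RingQuot.mkAlgHom ℂ (WeylRel σ) (FreeAlgebra.ι ℂ (Sum.inl i))

/-- The derivation `∂_i`. -/
def D (i : σ) : WeylAlgebra σ :=
  RingQuot.mkAlgHom ℂ (WeylRel σ) (FreeAlgebra.ι ℂ (Sum.inr i))

theorem X_mul_X (i j : σ) : (X i * X j : WeylAlgebra σ) = X j * X i := by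
  have h := RingQuot.mkAlgHom_rel ℂ (WeylRel.xx i j)
  rw [map_mul, map_mul] at h
  exact h

theorem adjoin_X_comm (p : WeylAlgebra σ) (hp : p ∈ Set.range (X (σ := σ)))
    (q : WeylAlgebra σ) (hq : q ∈ Set.range (X (σ := σ))) : p * q = q * p := by
  obtain ⟨i, rfl⟩ := hp
  obtain ⟨j, rfl⟩ := hq
  exact X_mul_X i j

/-- The homomorphism `ℂ[x] → ℂ⟨x, ∂⟩` with `x_i ↦ x_i`: a polynomial as a differential operator of
order zero. -/
def ofPoly (σ : Type) : MvPolynomial σ ℂ →ₐ[ℂ] WeylAlgebra σ :=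
  letI : CommRing (Algebra.adjoin ℂ (Set.range (X (σ := σ)))) :=
    { (Algebra.adjoin ℂ (Set.range (X (σ := σ)))).toRing with
      mul_comm := (Algebra.isMulCommutative_adjoin ℂ adjoin_X_comm).is_comm.comm }
  (Algebra.adjoin ℂ (Set.range (X (σ := σ)))).val.comp
    (MvPolynomial.aeval fun i => ⟨X i, Algebra.subset_adjoin ⟨i, rfl⟩⟩)

theorem ofPoly_X (i : σ) : ofPoly σ (MvPolynomial.X i) = X i := by
  simp [ofPoly]

/-- The algebra homomorphism from the Weyl algebra given by operators that satisfy the defining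
relations. -/
def lift {A : Type*} [Ring A] [Algebra ℂ A] (x d : σ → A)
    (hxx : ∀ i j, x i * x j = x j * x i) (hdd : ∀ i j, d i * d j = d j * d i)
    (hne : ∀ i j, i ≠ j → d i * x j = x j * d i) (hself : ∀ i, d i * x i = x i * d i + 1) :
    WeylAlgebra σ →ₐ[ℂ] A :=
  RingQuot.liftAlgHom ℂ
    ⟨FreeAlgebra.lift ℂ (Sum.elim x d), by
      intro u v h
      cases h with
      | xx i j => simpa using hxx i j
      | dd i j => simpa using hdd i j
      | dx_ne i j h => simpa using hne i j h
      | dx_self i => simpa using hself i⟩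

theorem lift_X {A : Type*} [Ring A] [Algebra ℂ A] (x d : σ → A) (hxx hdd hne hself) (i : σ) :
    lift x d hxx hdd hne hself (X i) = x i := by
  unfold lift X
  erw [RingQuot.liftAlgHom_mkAlgHom_apply]
  simp

theorem lift_D {A : Type*} [Ring A] [Algebra ℂ A] (x d : σ → A) (hxx hdd hne hself) (i : σ) :
    lift x d hxx hdd hne hself (D i) = d i := by
  unfold lift D
  erw [RingQuot.liftAlgHom_mkAlgHom_apply]
  simp

/-- The holonomic rank of a left module `M` over the Weyl algebra: the dimension of
`ℂ(x) ⊗_{ℂ[x]} M` as a vector space over the field `ℂ(x)` of rational functions.  (By the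
convention for `Module.finrank` the value is `0` if this dimension is infinite, so that a positive
lower bound for it contains the finiteness of the dimension.) -/
def holonomicRank (σ : Type) (M : Type*) [AddCommGroup M] [Module (WeylAlgebra σ) M] : ℕ :=
  letI : Module (MvPolynomial σ ℂ) M := Module.compHom M (ofPoly σ).toRingHom
  Module.finrank (FractionRing (MvPolynomial σ ℂ))
    (FractionRing (MvPolynomial σ ℂ) ⊗[MvPolynomial σ ℂ] M)

end WeylAlgebra

/-! ### Holomorphic functions as a module over the Weyl algebra, and solutions -/

/-- The space `𝒪(Ω)` of holomorphic functions on the open set `Ω ⊆ ℂ^σ`.  A function on `Ω` is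
represented by its extension by zero to `ℂ^σ`. -/
def Holo {σ : Type} [Fintype σ] (Ω : TopologicalSpace.Opens (σ → ℂ)) :
    Submodule ℂ ((σ → ℂ) → ℂ) where
  carrier := {f | AnalyticOnNhd ℂ f Ω ∧ ∀ z ∉ Ω, f z = 0}
  zero_mem' := ⟨analyticOnNhd_const, fun _ _ => rfl⟩
  add_mem' := fun hf hg => ⟨hf.1.add hg.1, fun z hz => by simp [hf.2 z hz, hg.2 z hz]⟩
  smul_mem' := fun c f hf =>
    ⟨(analyticOnNhd_const (v := c)).smul hf.1, fun z hz => by simp [hf.2 z hz]⟩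

namespace Holo

variable {σ : Type} [Fintype σ] {Ω : TopologicalSpace.Opens (σ → ℂ)}

theorem ext_on {f g : Holo Ω} (h : ∀ z ∈ Ω, f.1 z = g.1 z) : f = g := by
  apply Subtype.ext
  funext z
  by_cases hz : z ∈ Ω
  · exact h z hz
  · rw [f.2.2 z hz, g.2.2 z hz]

/-- Multiplication by the coordinate function `z_i` on `𝒪(Ω)`. -/
def mulX (Ω : TopologicalSpace.Opens (σ → ℂ)) (i : σ) : Module.End ℂ (Holo Ω) where
  toFun f := ⟨fun z => z i * f.1 z,
    ⟨fun z hz => ((ContinuousLinearMap.proj (R := ℂ) (φ := fun _ : σ => ℂ) i).analyticAt z).mul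
      (f.2.1 z hz), fun z hz => by simp [f.2.2 z hz]⟩⟩
  map_add' f g := by
    apply Subtype.ext
    funext z
    simp [mul_add]
  map_smul' c f := by
    apply Subtype.ext
    funext z
    simp [mul_left_comm]

theorem mulX_apply (i : σ) (f : Holo Ω) (z : σ → ℂ) : (mulX Ω i f).1 z = z i * f.1 z := rfl

variable [DecidableEq σ]

/-- The partial derivative `∂/∂z_i` on `𝒪(Ω)`. -/
def pderiv (Ω : TopologicalSpace.Opens (σ → ℂ)) (i : σ) : Module.End ℂ (Holo Ω) where
  toFun f := ⟨(Ω : Set (σ → ℂ)).indicator fun z => fderiv ℂ f.1 z (Pi.single i 1), by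
    constructor
    · have h : AnalyticOnNhd ℂ (fun z => fderiv ℂ f.1 z (Pi.single i 1)) Ω := fun z hz =>
        AnalyticAt.fun_comp ((ContinuousLinearMap.apply ℂ ℂ (Pi.single i (1 : ℂ)) :
          ((σ → ℂ) →L[ℂ] ℂ) →L[ℂ] ℂ).analyticAt _) (f.2.1.fderiv z hz)
      refine h.congr Ω.isOpen fun z hz => ?_
      rw [Set.indicator_of_mem hz]
    · intro z hz
      exact Set.indicator_of_notMem hz _⟩
  map_add' f g := ext_on fun z hz => by
    have hz' : z ∈ (Ω : Set (σ → ℂ)) := hz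
    have hf := (f.2.1 z hz).differentiableAt
    have hg := (g.2.1 z hz).differentiableAt
    have h : fderiv ℂ (f.1 + g.1) z = fderiv ℂ f.1 z + fderiv ℂ g.1 z := fderiv_add hf hg
    simp [hz', h]
  map_smul' c f := ext_on fun z hz => by
    have hz' : z ∈ (Ω : Set (σ → ℂ)) := hz
    have hf := (f.2.1 z hz).differentiableAt
    have h : fderiv ℂ (c • f.1) z = c • fderiv ℂ f.1 z := fderiv_const_smul hf c
    simp [hz', h]

theorem pderiv_apply (i : σ) (f : Holo Ω) {z : σ → ℂ} (hz : z ∈ Ω) :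
    (pderiv Ω i f).1 z = fderiv ℂ f.1 z (Pi.single i 1) :=
  Set.indicator_of_mem (s := (Ω : Set (σ → ℂ))) hz
    fun z => fderiv ℂ f.1 z (Pi.single i (1 : ℂ))

theorem pderiv_comm (i j : σ) : pderiv Ω i * pderiv Ω j = pderiv Ω j * pderiv Ω i := by
  have key : ∀ (i j : σ) (f : Holo Ω) (z : σ → ℂ), z ∈ Ω →
      (pderiv Ω i (pderiv Ω j f)).1 z =
        fderiv ℂ (fderiv ℂ f.1) z (Pi.single i 1) (Pi.single j 1) := by
    intro i j f z hz
    rw [pderiv_apply i _ hz]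
    have h : (pderiv Ω j f).1 =ᶠ[𝓝 z] fun w => fderiv ℂ f.1 w (Pi.single j 1) := by
      filter_upwards [Ω.isOpen.mem_nhds hz] with w hw
      exact pderiv_apply j f hw
    rw [h.fderiv_eq]
    have hd : DifferentiableAt ℂ (fderiv ℂ f.1) z := (f.2.1.fderiv z hz).differentiableAt
    rw [fderiv_clm_apply hd (differentiableAt_const _)]
    simp
  refine LinearMap.ext fun f => ext_on fun z hz => ?_
  change (pderiv Ω i (pderiv Ω j f)).1 z = (pderiv Ω j (pderiv Ω i f)).1 z
  rw [key i j f z hz, key j i f z hz]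
  have hs : IsSymmSndFDerivAt ℂ f.1 z :=
    ((f.2.1 z hz).contDiffAt (n := ⊤)).isSymmSndFDerivAt (by simp)
  exact hs.eq _ _

theorem pderiv_mulX (i j : σ) (f : Holo Ω) {z : σ → ℂ} (hz : z ∈ Ω) :
    (pderiv Ω i (mulX Ω j f)).1 z =
      z j * (pderiv Ω i f).1 z + (Pi.single i (1 : ℂ) : σ → ℂ) j * f.1 z := by
  rw [pderiv_apply i _ hz, pderiv_apply i _ hz]
  have hf := (f.2.1 z hz).differentiableAt
  have hp : HasFDerivAt (fun w : σ → ℂ => w j)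
      (ContinuousLinearMap.proj (R := ℂ) (φ := fun _ : σ => ℂ) j) z :=
    (ContinuousLinearMap.proj (R := ℂ) (φ := fun _ : σ => ℂ) j).hasFDerivAt
  have h : fderiv ℂ (mulX Ω j f).1 z = _ := (hp.mul hf.hasFDerivAt).fderiv
  rw [h]
  simp [mul_comm]

/-- The action of differential operators with polynomial coefficients on holomorphic functions:
`x_i` acts by multiplication with `z_i`, and `∂_i` by the partial derivative. -/
def action (Ω : TopologicalSpace.Opens (σ → ℂ)) :
    WeylAlgebra σ →ₐ[ℂ] Module.End ℂ (Holo Ω) :=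
  WeylAlgebra.lift (mulX Ω) (pderiv Ω)
    (fun i j => LinearMap.ext fun f => ext_on fun z _ => by
      simp [mulX_apply, mul_left_comm])
    pderiv_comm
    (fun i j hij => LinearMap.ext fun f => ext_on fun z hz => by
      change (pderiv Ω i (mulX Ω j f)).1 z = z j * (pderiv Ω i f).1 z
      rw [pderiv_mulX i j f hz, Pi.single_eq_of_ne hij.symm]
      simp)
    (fun i => LinearMap.ext fun f => ext_on fun z hz => by
      change (pderiv Ω i (mulX Ω i f)).1 z = z i * (pderiv Ω i f).1 z + f.1 z
      rw [pderiv_mulX i i f hz, Pi.single_eq_same]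
      simp)

instance : Module (WeylAlgebra σ) (Holo Ω) := Module.compHom (Holo Ω) (action Ω).toRingHom

theorem X_smul (i : σ) (f : Holo Ω) : WeylAlgebra.X i • f = mulX Ω i f := by
  change (action Ω (WeylAlgebra.X i)) f = _
  rw [action, WeylAlgebra.lift_X]

theorem D_smul (i : σ) (f : Holo Ω) : WeylAlgebra.D i • f = pderiv Ω i f := by
  change (action Ω (WeylAlgebra.D i)) f = _
  rw [action, WeylAlgebra.lift_D]

end Holo

/-- A family `(h_i)` of holomorphic functions on `Ω` is a solution of the left module
`M = (⊕_i D g_i) / N` over the Weyl algebra `D` if there is a morphism `M → 𝒪(Ω)` of left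
`D`-modules that maps the class of the basis vector `g_i` to `h_i` for all `i`. -/
def IsSolution {σ : Type} [Fintype σ] [DecidableEq σ] {ι : Type}
    (N : Submodule (WeylAlgebra σ) (ι →₀ WeylAlgebra σ))
    {Ω : TopologicalSpace.Opens (σ → ℂ)} (h : ι → Holo Ω) : Prop :=
  ∃ ψ : ((ι →₀ WeylAlgebra σ) ⧸ N) →ₗ[WeylAlgebra σ] Holo Ω,
    ∀ i, ψ (N.mkQ (Finsupp.single i 1)) = h i

/-! ### Polyhedra -/

/-- The dimension of a subset of `ℝ^m`: the dimension of its affine hull, and `-1` for the empty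
set. -/
def affDim {m : ℕ} (S : Set (Fin m → ℝ)) : ℤ :=
  open Classical in
  if S = ∅ then -1 else (Module.finrank ℝ (affineSpan ℝ S).direction : ℤ)

/-- `F` is a face of `P`: it is cut out of `P` by the equality case of an inequality
`∑ c_i x_i + c_0 ≥ 0` that is valid for `P`. -/
def IsFace {d : ℕ} (P F : Set (Fin d → ℝ)) : Prop :=
  ∃ (c : Fin d → ℝ) (c₀ : ℝ), (∀ x ∈ P, 0 ≤ ∑ i, c i * x i + c₀) ∧
    F = P ∩ {x | ∑ i, c i * x i + c₀ = 0}

/-- `F` is a facet of `P`: a face of dimension `dim P - 1`. -/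
def IsFacet {d : ℕ} (P F : Set (Fin d → ℝ)) : Prop :=
  IsFace P F ∧ affDim F = affDim P - 1

/-- The index set of the variables `a_{ij}` (namely `Sum.inl (i, j)`) and `b_j` (namely
`Sum.inr j`), where `1 ≤ i ≤ d` and `1 ≤ j ≤ n`.  A pair `(a, b)` of a `d × n` matrix and a vector
of length `n` is a function on this index set. -/
abbrev Var (d n : ℕ) : Type := (Fin d × Fin n) ⊕ Fin n

/-- The affine form `f_j(a, b, x) = ∑_i a_{ij} x_i + b_j`, where `p = (a, b)`. -/
def affForm {d n : ℕ} (p : Var d n → ℝ) (j : Fin n) (x : Fin d → ℝ) : ℝ :=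
  ∑ i, p (Sum.inl (i, j)) * x i + p (Sum.inr j)

/-- The polyhedron `P = {x : f_j(a, b, x) ≥ 0 for all j}`, where `p = (a, b)`. -/
def polyhedron {d n : ℕ} (p : Var d n → ℝ) : Set (Fin d → ℝ) :=
  {x | ∀ j, 0 ≤ affForm p j x}

/-- The set `F_j`, the part of the polyhedron on the hyperplane `f_j(a, b, x) = 0`. -/
def facetSet {d n : ℕ} (p : Var d n → ℝ) (j : Fin n) : Set (Fin d → ℝ) :=
  polyhedron p ∩ {x | affForm p j x = 0}

/-- The half-spaces `{f_j ≥ 0}`, `1 ≤ j ≤ n`, form the family of the bounding half-spaces of the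
polyhedron `P`: the sets `F_1, …, F_n` are all the facets of `P`, each listed once. -/
def IsBoundingFamily {d n : ℕ} (p : Var d n → ℝ) : Prop :=
  Set.BijOn (facetSet p) Set.univ {F | IsFacet (polyhedron p) F}

/-- The linear forms of the homogenization: `x_0` for the index `0` and
`b_j x_0 + ∑_i a_{ij} x_i` for the index `j ∈ {1, …, n}`. -/
def homForm {d n : ℕ} (p : Var d n → ℝ) (j : Fin (n + 1)) (x : Fin (d + 1) → ℝ) : ℝ :=
  Fin.cases (x 0) (fun k => p (Sum.inr k) * x 0 + ∑ i, p (Sum.inl (i, k)) * x (Fin.succ i)) j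

/-- The cone `F̂_J`, for `J ⊆ {0, …, n}`: the points of all the half-spaces of the homogenization
that lie on the boundary of those with index in `J`. -/
def homFace {d n : ℕ} (p : Var d n → ℝ) (J : Finset (Fin (n + 1))) : Set (Fin (d + 1) → ℝ) :=
  {x | (∀ j ∈ J, homForm p j x = 0) ∧ ∀ j, 0 ≤ homForm p j x}

/-- The family of half-spaces given by `p = (a, b)` is in general position. -/
def InGeneralPosition {d n : ℕ} (p : Var d n → ℝ) : Prop :=
  ∀ J : Finset (Fin (n + 1)),
    affDim (homFace p J) = (d : ℤ) + 1 - (J.card : ℤ) ∨ homFace p J = {0}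

/-- The abstract simplicial complex `ℱ` of the polyhedron, the nerve of `F_1, …, F_n`: all sets `J`
of indices such that `F_J = ⋂_{j ∈ J} F_j` is nonempty (with `F_∅ = P`). -/
def nerve {d n : ℕ} (p : Var d n → ℝ) : Set (Finset (Fin n)) :=
  {J | {x | x ∈ polyhedron p ∧ ∀ j ∈ J, x ∈ facetSet p j}.Nonempty}

/-! ### The functions `φ_F` -/

/-- The Heaviside function. -/
def heaviside (t : ℝ) : ℝ :=
  open Classical in
  if 0 ≤ t then 1 else 0

/-- `φ_F(a, b) = ∫_{ℝ^d} (2π)^{-d/2} exp(-|x|²/2) ∏_{j ∈ F} (H(f_j(a, b, x)) - 1) dx`, where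
`p = (a, b)`. -/
def phi {d n : ℕ} (F : Finset (Fin n)) (p : Var d n → ℝ) : ℝ :=
  ∫ x : Fin d → ℝ, 1 / (2 * Real.pi) ^ ((d : ℝ) / 2) * Real.exp (-(1 / 2) * ∑ i, x i ^ 2) *
    ∏ j ∈ F, (heaviside (affForm p j x) - 1)

/-- The Gram matrix `α_F(a)` of the columns of `a` with index in `F`. -/
def gramMatrix {d n : ℕ} (F : Finset (Fin n)) (p : Var d n → ℝ) : Matrix F F ℝ :=
  fun i j => ∑ k, p (Sum.inl (k, i.1)) * p (Sum.inl (k, j.1))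

/-! ### The module `M` -/

section System

variable {d n : ℕ} (p : Var d n → ℝ)

/-- The variable `a_{ij}` in the Weyl algebra. -/
def aVar (i : Fin d) (j : Fin n) : WeylAlgebra (Var d n) := WeylAlgebra.X (Sum.inl (i, j))

/-- The variable `b_j` in the Weyl algebra. -/
def bVar (j : Fin n) : WeylAlgebra (Var d n) := WeylAlgebra.X (Sum.inr j)

/-- The derivation `∂/∂a_{ij}`. -/
def aDer (i : Fin d) (j : Fin n) : WeylAlgebra (Var d n) := WeylAlgebra.D (Sum.inl (i, j))

/-- The derivation `∂/∂b_j`. -/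
def bDer (d : ℕ) {n : ℕ} (j : Fin n) : WeylAlgebra (Var d n) := WeylAlgebra.D (Sum.inr j)

/-- The operator `∂_b^J = ∏_{j ∈ J} ∂/∂b_j` (the factors commute). -/
def bDerProd (d : ℕ) {n : ℕ} (J : Finset (Fin n)) : WeylAlgebra (Var d n) :=
  ((J.sort (· ≤ ·)).map fun j => bDer d j).prod

/-- The basis vector `g^J` of the free module with basis `ℱ`, and `g^J = 0` if `J ∉ ℱ`. -/
def gVec (J : Finset (Fin n)) : nerve p →₀ WeylAlgebra (Var d n) :=
  open Classical in
  if h : J ∈ nerve p then Finsupp.single ⟨J, h⟩ 1 else 0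

/-- The left submodule `N` of the free module with basis `g^J`, `J ∈ ℱ`, that is generated by
* `(∂_{a_{ij}} - ∑_k a_{ik} ∂_{b_k} ∂_{b_j}) g^J` for all `i`, `j` and all `J ∈ ℱ`;
* `∂_{b_j} g^J - g^{J ∪ {j}}` for all `J ∈ ℱ` and `j ∉ J`;
* `(b_j + ∑_k ∑_i a_{ij} a_{ik} ∂_{b_k}) g^J` for all `J ∈ ℱ` and `j ∈ J`. -/
def systemN : Submodule (WeylAlgebra (Var d n)) (nerve p →₀ WeylAlgebra (Var d n)) :=
  Submodule.span (WeylAlgebra (Var d n))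
    ({v | ∃ J ∈ nerve p, ∃ (i : Fin d) (j : Fin n),
        v = (aDer i j - ∑ k, aVar i k * bDer d k * bDer d j) • gVec p J} ∪
     {v | ∃ J ∈ nerve p, ∃ j ∉ J, v = bDer d j • gVec p J - gVec p (insert j J)} ∪
     {v | ∃ J ∈ nerve p, ∃ j ∈ J,
        v = (bVar j + ∑ k, ∑ i : Fin d, aVar i j * aVar i k * bDer d k) • gVec p J})

/-- The left module `M`, the quotient of the free module with basis `g^J`, `J ∈ ℱ`, by `N`. -/
abbrev SystemM : Type := (nerve p →₀ WeylAlgebra (Var d n)) ⧸ systemN p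

end System

/-- The tube `{(a, b) : a ∈ U, b ∈ ℂ^n}` over an open set `U` of complex `d × n` matrices. -/
def tube {d n : ℕ} (U : TopologicalSpace.Opens (Fin d × Fin n → ℂ)) :
    TopologicalSpace.Opens (Var d n → ℂ) :=
  ⟨{z | (fun q => z (Sum.inl q)) ∈ U}, U.isOpen.preimage (by fun_prop)⟩

end

noncomputable section

open MeasureTheory

/-- An integral of exponentials of linear functionals is an analytic function of the parameter. -/
theorem hasFPowerSeries_integral_cexp {E α : Type*} [NormedAddCommGroup E] [NormedSpace ℂ E]
    [MeasurableSpace α] {μ : Measure α} {L : α → E →L[ℂ] ℂ} {ρ : α → ℂ}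
    (hL : AEStronglyMeasurable L μ) (hρ : AEStronglyMeasurable ρ μ) (c : E) {r : NNReal}
    (hr : 0 < r)
    (hint : Integrable (fun w => ‖ρ w‖ * Real.exp ((L w c).re + r * ‖L w‖)) μ) :
    AnalyticAt ℂ (fun c => ∫ w, ρ w * Complex.exp (L w c) ∂μ) c ∧
    ∀ v, fderiv ℂ (fun c => ∫ w, ρ w * Complex.exp (L w c) ∂μ) c v =
      ∫ w, L w v * (ρ w * Complex.exp (L w c)) ∂μ := by
  set T : (k : ℕ) → α → ContinuousMultilinearMap ℂ (fun _ : Fin k => E) ℂ := fun k w =>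
    (ρ w * Complex.exp (L w c) / (k.factorial : ℂ)) •
      (ContinuousMultilinearMap.mkPiAlgebraFin ℂ k ℂ).compContinuousLinearMap (fun _ => L w)
    with hT
  set B : α → ℝ := fun w => ‖ρ w‖ * Real.exp ((L w c).re + r * ‖L w‖) with hB
  have hLc : ∀ v, AEStronglyMeasurable (fun w => L w v) μ := fun v =>
    (ContinuousLinearMap.apply ℂ ℂ v).continuous.comp_aestronglyMeasurable hL
  have hwt : AEStronglyMeasurable (fun w => ρ w * Complex.exp (L w c)) μ :=
    hρ.mul (Complex.continuous_exp.comp_aestronglyMeasurable (hLc c))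
  have hTm : ∀ k, AEStronglyMeasurable (T k) μ := by
    intro k
    have h1 : Continuous fun l : E →L[ℂ] ℂ =>
        (ContinuousMultilinearMap.mkPiAlgebraFin ℂ k ℂ).compContinuousLinearMap
          (fun _ : Fin k => l) := by
      have h2 := (ContinuousMultilinearMap.compContinuousLinearMapContinuousMultilinear ℂ
        (fun _ : Fin k => E) (fun _ : Fin k => ℂ) ℂ).cont
      have h3 : Continuous fun l : E →L[ℂ] ℂ => (fun _ : Fin k => l) := by fun_prop
      exact (h2.comp h3).clm_apply continuous_const
    have h4 : AEStronglyMeasurable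
        (fun w => ρ w * Complex.exp (L w c) / (k.factorial : ℂ)) μ := by
      simpa only [div_eq_mul_inv] using hwt.mul_const _
    exact h4.smul (h1.comp_aestronglyMeasurable hL)
  have hnorm : ∀ w, ‖ρ w * Complex.exp (L w c)‖ = ‖ρ w‖ * Real.exp (L w c).re := fun w => by
    rw [norm_mul, Complex.norm_exp]
  have hTb : ∀ k w, ‖T k w‖ * (r : ℝ) ^ k ≤
      ‖ρ w‖ * Real.exp (L w c).re * ((r * ‖L w‖) ^ k / (k.factorial : ℝ)) := by
    intro k w
    have h1 : ‖(ContinuousMultilinearMap.mkPiAlgebraFin ℂ k ℂ).compContinuousLinearMap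
          (fun _ : Fin k => L w)‖ ≤ ‖L w‖ ^ k := by
      refine (ContinuousMultilinearMap.norm_compContinuousLinearMap_le _ _).trans ?_
      simp
    have h2 : ‖T k w‖ ≤ ‖ρ w‖ * Real.exp (L w c).re / (k.factorial : ℝ) * ‖L w‖ ^ k := by
      simp only [hT]
      rw [norm_smul, norm_div, hnorm]
      simp only [Complex.norm_natCast]
      gcongr
    calc ‖T k w‖ * (r : ℝ) ^ k ≤
        ‖ρ w‖ * Real.exp (L w c).re / (k.factorial : ℝ) * ‖L w‖ ^ k * (r : ℝ) ^ k := by gcongr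
      _ = _ := by rw [mul_pow]; ring
  have hsum : ∀ w, HasSum (fun k : ℕ => ‖ρ w‖ * Real.exp (L w c).re *
      ((r * ‖L w‖) ^ k / (k.factorial : ℝ))) (B w) := by
    intro w
    simp only [hB, Real.exp_add, ← mul_assoc]
    refine HasSum.mul_left _ ?_
    rw [Real.exp_eq_exp_ℝ]
    exact NormedSpace.expSeries_div_hasSum_exp (r * ‖L w‖)
  have hterm : ∀ k w, ‖ρ w‖ * Real.exp (L w c).re * ((r * ‖L w‖) ^ k / (k.factorial : ℝ)) ≤ B w :=
    fun k w => le_hasSum (hsum w) k fun _ _ => by positivity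
  have hTi : ∀ k, Integrable (T k) μ := by
    intro k
    refine (hint.mul_const (((r : ℝ) ^ k)⁻¹)).mono' (hTm k) (ae_of_all _ fun w => ?_)
    rw [le_mul_inv_iff₀ (by positivity)]
    exact (hTb k w).trans (hterm k w)
  have key : HasFPowerSeriesOnBall (fun c => ∫ w, ρ w * Complex.exp (L w c) ∂μ)
      (fun k => ∫ w, T k w ∂μ) c r := by
    refine ⟨?_, by simpa using hr, ?_⟩
    · refine FormalMultilinearSeries.le_radius_of_bound _ (∫ w, B w ∂μ) fun k => ?_
      calc ‖∫ w, T k w ∂μ‖ * (r : ℝ) ^ k ≤ (∫ w, ‖T k w‖ ∂μ) * (r : ℝ) ^ k := by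
            gcongr; exact norm_integral_le_integral_norm _
        _ = ∫ w, ‖T k w‖ * (r : ℝ) ^ k ∂μ := (integral_mul_const _ _).symm
        _ ≤ ∫ w, B w ∂μ := integral_mono ((hTi k).norm.mul_const _) hint
            fun w => (hTb k w).trans (hterm k w)
    · intro y hy
      have hy' : ‖y‖ ≤ r := by
        have : ‖y‖ₑ < r := by rwa [mem_eball_zero_iff] at hy
        have h' : ‖y‖₊ < r := by
          rwa [enorm_eq_nnnorm, ENNReal.coe_lt_coe] at this
        exact_mod_cast h'.le
      have happ : ∀ k, (∫ w, T k w ∂μ) (fun _ => y) = ∫ w, T k w (fun _ => y) ∂μ := fun k =>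
        ContinuousMultilinearMap.integral_apply (hTi k) _
      have hval : ∀ k w, T k w (fun _ => y) =
          ρ w * Complex.exp (L w c) * ((L w y) ^ k / (k.factorial : ℂ)) := by
        intro k w
        simp only [hT, _root_.smul_apply,
          ContinuousMultilinearMap.compContinuousLinearMap_apply,
          ContinuousMultilinearMap.mkPiAlgebraFin_apply, List.ofFn_const, List.prod_replicate,
          smul_eq_mul]
        ring
      simp only [happ]
      refine hasSum_integral_of_dominated_convergence
        (fun k w => ‖ρ w‖ * Real.exp (L w c).re * ((r * ‖L w‖) ^ k / (k.factorial : ℝ)))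
        (fun k => ?_) (fun k => ae_of_all _ fun w => ?_)
        (ae_of_all _ fun w => (hsum w).summable) ?_ (ae_of_all _ fun w => ?_)
      · simp only [hval]
        simp only [div_eq_mul_inv]
        exact hwt.mul (((hLc y).pow k).mul_const _)
      · refine le_trans ?_ (hTb k w)
        refine ((T k w).le_opNorm _).trans ?_
        gcongr
        simpa using pow_le_pow_left₀ (norm_nonneg y) hy' k
      · refine hint.congr (ae_of_all _ fun w => ?_)
        exact (hsum w).tsum_eq.symm
      · simp only [hval, map_add, Complex.exp_add, ← mul_assoc]
        refine HasSum.mul_left _ ?_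
        rw [Complex.exp_eq_exp_ℂ]
        exact NormedSpace.expSeries_div_hasSum_exp (L w y)
  refine ⟨key.analyticAt, fun v => ?_⟩
  rw [key.hasFPowerSeriesAt.hasFDerivAt.fderiv]
  have : continuousMultilinearCurryFin1 ℂ E ℂ (∫ w, T 1 w ∂μ) v = (∫ w, T 1 w ∂μ) (fun _ => v) := by
    rw [continuousMultilinearCurryFin1_apply]
    congr 1
  rw [this, ContinuousMultilinearMap.integral_apply (hTi 1)]
  congr 1
  funext w
  simp [hT]
  ring

/-! ### Gaussian integrals depending on parameters -/

section ExpInt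

variable {d n : ℕ}

/-- The complex variables dual to `b`, on a shifted copy of `ℝ^F`: `2πi w_k - 1` for `k ∈ F`, and
`0` for `k ∉ F`. -/
def expVar (F : Finset (Fin n)) (w : EuclideanSpace ℝ F) (k : Fin n) : ℂ :=
  if h : k ∈ F then 2 * Real.pi * Complex.I * (w ⟨k, h⟩ : ℂ) - 1 else 0

theorem expVar_of_notMem {F : Finset (Fin n)} {k : Fin n} (h : k ∉ F) (w : EuclideanSpace ℝ F) :
    expVar F w k = 0 := by simp [expVar, h]

theorem expVar_of_mem {F : Finset (Fin n)} {k : Fin n} (h : k ∈ F) (w : EuclideanSpace ℝ F) :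
    expVar F w k = 2 * Real.pi * Complex.I * (w ⟨k, h⟩ : ℂ) - 1 := by simp [expVar, h]

theorem expVar_ne_zero {F : Finset (Fin n)} {k : Fin n} (h : k ∈ F) (w : EuclideanSpace ℝ F) :
    expVar F w k ≠ 0 := by
  intro h0
  have := congrArg Complex.re h0
  simp [expVar_of_mem h] at this

theorem one_le_norm_expVar {F : Finset (Fin n)} {k : Fin n} (h : k ∈ F)
    (w : EuclideanSpace ℝ F) : 1 ≤ ‖expVar F w k‖ := by
  have := Complex.abs_re_le_norm (expVar F w k)
  simpa [expVar_of_mem h] using this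

theorem continuous_expVar (F : Finset (Fin n)) (k : Fin n) :
    Continuous fun w => expVar F w k := by
  unfold expVar
  split_ifs <;> fun_prop

theorem norm_expVar_le (F : Finset (Fin n)) (w : EuclideanSpace ℝ F) (k : Fin n) :
    ‖expVar F w k‖ ≤ 8 * (1 + ‖w‖) := by
  by_cases h : k ∈ F
  · rw [expVar_of_mem h]
    have h1 : ‖w ⟨k, h⟩‖ ≤ ‖w‖ := PiLp.norm_apply_le w _
    have h2 : ‖(2 * Real.pi * Complex.I * (w ⟨k, h⟩ : ℂ) : ℂ)‖ = 2 * Real.pi * ‖w ⟨k, h⟩‖ := by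
      simp [abs_of_pos Real.pi_pos]
    refine (norm_sub_le _ _).trans ?_
    rw [h2, norm_one]
    nlinarith [Real.pi_lt_four, Real.pi_pos, norm_nonneg w, norm_nonneg (w ⟨k, h⟩)]
  · rw [expVar_of_notMem h, norm_zero]
    positivity

/-- The exponent, as a linear form in the quadratic and the linear coefficients. -/
def expForm (F : Finset (Fin n)) (w : EuclideanSpace ℝ F) : (Var n n → ℂ) →L[ℂ] ℂ :=
  (∑ k, expVar F w k • ContinuousLinearMap.proj (R := ℂ) (φ := fun _ : Var n n => ℂ) (Sum.inr k)) +
  ∑ k, ∑ l, (1 / 2 * (expVar F w k * expVar F w l)) •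
    ContinuousLinearMap.proj (R := ℂ) (φ := fun _ : Var n n => ℂ) (Sum.inl (k, l))

theorem expForm_apply (F : Finset (Fin n)) (w : EuclideanSpace ℝ F) (c : Var n n → ℂ) :
    expForm F w c = ∑ k, expVar F w k * c (Sum.inr k) +
      ∑ k, ∑ l, 1 / 2 * (expVar F w k * expVar F w l) * c (Sum.inl (k, l)) := by
  simp [expForm]

theorem continuous_expForm (F : Finset (Fin n)) : Continuous (expForm F) := by
  unfold expForm
  have := continuous_expVar F
  fun_prop

theorem exists_norm_expForm_le (F : Finset (Fin n)) :
    ∃ K : ℝ, 0 < K ∧ ∀ w, ‖expForm F w‖ ≤ K * (1 + ‖w‖ ^ 2) := by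
  refine ⟨n * 16 + n * (n * 64) + 1, by positivity, fun w => ?_⟩
  have hp : ∀ v : Var n n,
      ‖ContinuousLinearMap.proj (R := ℂ) (φ := fun _ : Var n n => ℂ) v‖ ≤ 1 := fun v =>
    ContinuousLinearMap.opNorm_le_bound _ zero_le_one fun x => by
      simpa using norm_le_pi_norm x v
  have h0 := norm_nonneg w
  have h1 : ∀ k, ‖expVar F w k • ContinuousLinearMap.proj (R := ℂ) (φ := fun _ : Var n n => ℂ)
      (Sum.inr k)‖ ≤ 16 * (1 + ‖w‖ ^ 2) := fun k => by
    rw [norm_smul]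
    refine (mul_le_of_le_one_right (norm_nonneg _) (hp _)).trans ?_
    nlinarith [norm_expVar_le F w k, sq_nonneg (‖w‖ - 1)]
  have h2 : ∀ k l, ‖(1 / 2 * (expVar F w k * expVar F w l)) •
      ContinuousLinearMap.proj (R := ℂ) (φ := fun _ : Var n n => ℂ) (Sum.inl (k, l))‖ ≤
        64 * (1 + ‖w‖ ^ 2) := fun k l => by
    rw [norm_smul]
    refine (mul_le_of_le_one_right (norm_nonneg _) (hp _)).trans ?_
    rw [norm_mul, norm_mul]
    have := mul_le_mul (norm_expVar_le F w k) (norm_expVar_le F w l) (norm_nonneg _) (by positivity)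
    norm_num
    nlinarith [sq_nonneg (‖w‖ - 1)]
  calc ‖expForm F w‖ ≤ (∑ _k : Fin n, 16 * (1 + ‖w‖ ^ 2)) +
        ∑ _k : Fin n, ∑ _l : Fin n, 64 * (1 + ‖w‖ ^ 2) :=
      (norm_add_le _ _).trans (add_le_add (norm_sum_le_of_le _ fun k _ => h1 k)
        (norm_sum_le_of_le _ fun k _ => norm_sum_le_of_le _ fun l _ => h2 k l))
    _ ≤ _ := by
      simp only [Finset.sum_const, Finset.card_univ, Fintype.card_fin, nsmul_eq_mul]
      nlinarith [sq_nonneg ‖w‖]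

/-- The coefficients for which the real part of the exponent tends to `-∞` quadratically. -/
def goodSet (F : Finset (Fin n)) : Set (Var n n → ℂ) :=
  {c | ∃ ε > 0, ∃ C : ℝ, ∀ w, (expForm F w c).re ≤ C - ε * ‖w‖ ^ 2}

theorem isOpen_goodSet (F : Finset (Fin n)) : IsOpen (goodSet F) := by
  obtain ⟨K, hK, hL⟩ := exists_norm_expForm_le F
  rw [Metric.isOpen_iff]
  rintro c ⟨ε, hε, C, h⟩
  refine ⟨ε / (2 * K), by positivity, fun c' hc' => ⟨ε / 2, by positivity, C + ε / 2, fun w => ?_⟩⟩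
  have h1 : ‖expForm F w (c' - c)‖ ≤ ε / 2 * (1 + ‖w‖ ^ 2) := by
    calc ‖expForm F w (c' - c)‖ ≤ K * (1 + ‖w‖ ^ 2) * (ε / (2 * K)) :=
          (expForm F w).le_of_opNorm_le_of_le (hL w) (mem_ball_iff_norm.1 hc').le
      _ = _ := by field_simp
  have h2 := (Complex.re_le_norm _).trans h1
  have h3 := h w
  rw [map_sub, Complex.sub_re] at h2
  linarith

/-- Continuous functions of at most exponential growth. -/
def Moderate {F : Finset (Fin n)} (ρ : EuclideanSpace ℝ F → ℂ) : Prop :=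
  Continuous ρ ∧ ∃ C N : ℝ, ∀ w, ‖ρ w‖ ≤ C * Real.exp (N * ‖w‖)

theorem Moderate.mul {F : Finset (Fin n)} {ρ σ : EuclideanSpace ℝ F → ℂ} (hρ : Moderate ρ)
    (hσ : Moderate σ) : Moderate fun w => ρ w * σ w := by
  obtain ⟨hρc, C, N, h⟩ := hρ
  obtain ⟨hσc, C', N', h'⟩ := hσ
  refine ⟨hρc.mul hσc, C * C', N + N', fun w => ?_⟩
  rw [norm_mul]
  calc _ ≤ (C * Real.exp (N * ‖w‖)) * (C' * Real.exp (N' * ‖w‖)) :=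
        mul_le_mul (h w) (h' w) (norm_nonneg _) ((norm_nonneg _).trans (h w))
    _ = _ := by rw [add_mul, Real.exp_add]; ring

theorem Moderate.of_bounded {F : Finset (Fin n)} {ρ : EuclideanSpace ℝ F → ℂ} (hρ : Continuous ρ)
    {C : ℝ} (h : ∀ w, ‖ρ w‖ ≤ C) : Moderate ρ :=
  ⟨hρ, C, 0, by simpa using h⟩

theorem moderate_expVar (F : Finset (Fin n)) (k : Fin n) : Moderate fun w => expVar F w k := by
  refine ⟨continuous_expVar F k, 8, 1, fun w => (norm_expVar_le F w k).trans ?_⟩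
  have := Real.add_one_le_exp (1 * ‖w‖)
  linarith

theorem integrable_exp_bound {F : Finset (Fin n)} {ρ : EuclideanSpace ℝ F → ℂ} (hρ : Moderate ρ)
    {c : Var n n → ℂ} (hc : c ∈ goodSet F) :
    ∃ r : NNReal, 0 < r ∧
      Integrable (fun w => ‖ρ w‖ * Real.exp ((expForm F w c).re + r * ‖expForm F w‖)) := by
  obtain ⟨K, hK, hL⟩ := exists_norm_expForm_le F
  obtain ⟨ε, hε, C, h⟩ := hc
  obtain ⟨hρc, C', N, hN⟩ := hρ
  have hr : 0 < ε / (2 * K) := by positivity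
  refine ⟨(ε / (2 * K)).toNNReal, Real.toNNReal_pos.2 hr, ?_⟩
  rw [Real.coe_toNNReal _ hr.le]
  have hg : Integrable fun w : EuclideanSpace ℝ F =>
      C' * Real.exp (C + ε / 2 + N ^ 2 / ε) * Real.exp (-(ε / 4) * ‖w‖ ^ 2) := by
    have h1 := (GaussianFourier.integrable_cexp_neg_mul_sq_norm_add
      (V := EuclideanSpace ℝ F) (b := ((ε / 4 : ℝ) : ℂ))
      (by rw [Complex.ofReal_re]; positivity) 0 0).norm
    refine (h1.congr (ae_of_all _ fun w => ?_)).const_mul _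
    simp only [Complex.norm_exp]
    congr 1
    simp [← Complex.ofReal_pow]
  refine hg.mono' ?_ (ae_of_all _ fun w => ?_)
  · have := continuous_expForm F
    refine Continuous.aestronglyMeasurable ?_
    fun_prop
  · rw [norm_mul, norm_norm, Real.norm_of_nonneg (Real.exp_pos _).le]
    have hC' : 0 ≤ C' * Real.exp (N * ‖w‖) := (norm_nonneg _).trans (hN w)
    have h2 : ε / (2 * K) * ‖expForm F w‖ ≤ ε / 2 * (1 + ‖w‖ ^ 2) := by
      calc ε / (2 * K) * ‖expForm F w‖ ≤ ε / (2 * K) * (K * (1 + ‖w‖ ^ 2)) := by gcongr; exact hL w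
        _ = _ := by field_simp
    have h3 : N * ‖w‖ ≤ ε / 4 * ‖w‖ ^ 2 + N ^ 2 / ε := by
      have : ε / 4 * ‖w‖ ^ 2 + N ^ 2 / ε - N * ‖w‖ = (ε * ‖w‖ / 2 - N) ^ 2 / ε := by
        field_simp; ring
      have h4 : 0 ≤ (ε * ‖w‖ / 2 - N) ^ 2 / ε := by positivity
      linarith
    have hC0 : 0 ≤ C' := nonneg_of_mul_nonneg_left hC' (Real.exp_pos _)
    calc _ ≤ C' * Real.exp (N * ‖w‖) *
          Real.exp (C - ε * ‖w‖ ^ 2 + ε / 2 * (1 + ‖w‖ ^ 2)) := by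
          refine mul_le_mul (hN w) (Real.exp_le_exp.2 ?_) (Real.exp_pos _).le hC'
          linarith [h w]
      _ = C' * Real.exp (N * ‖w‖ + (C - ε * ‖w‖ ^ 2 + ε / 2 * (1 + ‖w‖ ^ 2))) := by
          rw [Real.exp_add (N * ‖w‖)]; ring
      _ ≤ C' * Real.exp ((C + ε / 2 + N ^ 2 / ε) + -(ε / 4) * ‖w‖ ^ 2) := by
          refine mul_le_mul_of_nonneg_left (Real.exp_le_exp.2 ?_) hC0
          linarith
      _ = _ := by rw [Real.exp_add _ (-(ε / 4) * ‖w‖ ^ 2)]; ring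

theorem integrable_mul_cexp {F : Finset (Fin n)} {ρ : EuclideanSpace ℝ F → ℂ} (hρ : Moderate ρ)
    {c : Var n n → ℂ} (hc : c ∈ goodSet F) :
    Integrable (fun w => ρ w * Complex.exp (expForm F w c)) := by
  obtain ⟨r, -, h⟩ := integrable_exp_bound hρ hc
  refine h.mono' ?_ (ae_of_all _ fun w => ?_)
  · have := continuous_expForm F
    have := hρ.1
    refine Continuous.aestronglyMeasurable ?_
    fun_prop
  · rw [norm_mul, Complex.norm_exp]
    gcongr
    linarith [mul_nonneg r.coe_nonneg (norm_nonneg (expForm F w))]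

/-- The entries of the Gram matrix of the columns of `a`, and `b`. -/
def gramMap (z : Var d n → ℂ) : Var n n → ℂ :=
  Sum.elim (fun q => ∑ i, z (Sum.inl (i, q.1)) * z (Sum.inl (i, q.2))) fun k => z (Sum.inr k)

theorem expForm_gramMap (F : Finset (Fin n)) (w : EuclideanSpace ℝ F) (z : Var d n → ℂ) :
    expForm F w (gramMap z) = ∑ k, expVar F w k * z (Sum.inr k) +
      1 / 2 * ∑ i, (∑ k, z (Sum.inl (i, k)) * expVar F w k) ^ 2 := by
  rw [expForm_apply]
  congr 1
  simp only [gramMap, Sum.elim_inl, sq, Finset.sum_mul_sum]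
  rw [Finset.sum_comm (s := (Finset.univ : Finset (Fin d))), Finset.mul_sum]
  refine Finset.sum_congr rfl fun k _ => ?_
  rw [Finset.sum_comm, Finset.mul_sum]
  refine Finset.sum_congr rfl fun l _ => ?_
  rw [Finset.mul_sum, Finset.mul_sum]
  refine Finset.sum_congr rfl fun i _ => ?_
  ring

theorem differentiable_gramMap : Differentiable ℂ (gramMap : (Var d n → ℂ) → _) := by
  rw [differentiable_pi]
  rintro (⟨k, l⟩ | k) <;> simp only [gramMap, Sum.elim_inl, Sum.elim_inr] <;> fun_prop

theorem analyticOnNhd_gramMap : AnalyticOnNhd ℂ (gramMap : (Var d n → ℂ) → _) Set.univ := by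
  intro z _
  rw [analyticAt_pi_iff]
  have hp : ∀ v, AnalyticAt ℂ (fun z : Var d n → ℂ => z v) z := fun v =>
    (ContinuousLinearMap.proj (R := ℂ) (φ := fun _ : Var d n => ℂ) v).analyticAt z
  rintro (⟨k, l⟩ | k) <;> simp only [gramMap, Sum.elim_inl, Sum.elim_inr]
  · exact Finset.analyticAt_fun_sum _ fun i _ => (hp _).mul (hp _)
  · exact hp _

theorem fderiv_gramMap (z v : Var d n → ℂ) :
    fderiv ℂ gramMap z v = Sum.elim (fun q => ∑ i, (z (Sum.inl (i, q.1)) * v (Sum.inl (i, q.2)) +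
      z (Sum.inl (i, q.2)) * v (Sum.inl (i, q.1)))) fun k => v (Sum.inr k) := by
  have hp : ∀ u, HasFDerivAt (fun z : Var d n → ℂ => z u)
      (ContinuousLinearMap.proj (R := ℂ) (φ := fun _ : Var d n => ℂ) u) z := fun u =>
    (ContinuousLinearMap.proj (R := ℂ) (φ := fun _ : Var d n => ℂ) u).hasFDerivAt
  funext u
  have h : fderiv ℂ gramMap z v u = fderiv ℂ (fun z : Var d n → ℂ => gramMap z u) z v := by
    rw [fderiv_apply (𝕜 := ℂ) (differentiable_gramMap z)]
    rfl
  rw [h]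
  rcases u with ⟨k, l⟩ | k
  · have := HasFDerivAt.fun_sum (u := Finset.univ) fun (i : Fin d) _ =>
      (hp (Sum.inl (i, k))).mul (hp (Sum.inl (i, l)))
    simp only [gramMap, Sum.elim_inl]
    erw [this.fderiv]
    simp
  · simp only [gramMap, Sum.elim_inr]
    rw [(hp (Sum.inr k)).fderiv]
    rfl

/-- The integral of `ρ` against the exponential of the quadratic form given by `(a, b)`. -/
def expInt (F : Finset (Fin n)) (ρ : EuclideanSpace ℝ F → ℂ) (z : Var d n → ℂ) : ℂ :=
  ∫ w, ρ w * Complex.exp (expForm F w (gramMap z))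

theorem analyticAt_expInt {F : Finset (Fin n)} {ρ : EuclideanSpace ℝ F → ℂ} (hρ : Moderate ρ)
    {z : Var d n → ℂ} (hz : gramMap z ∈ goodSet F) : AnalyticAt ℂ (expInt F ρ) z := by
  obtain ⟨r, hr, h⟩ := integrable_exp_bound hρ hz
  exact AnalyticAt.comp (f := gramMap) (hasFPowerSeries_integral_cexp
    (continuous_expForm F).aestronglyMeasurable hρ.1.aestronglyMeasurable _ hr h).1
    (analyticOnNhd_gramMap z trivial)

theorem fderiv_expInt {F : Finset (Fin n)} {ρ : EuclideanSpace ℝ F → ℂ} (hρ : Moderate ρ)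
    {z : Var d n → ℂ} (hz : gramMap z ∈ goodSet F) (v : Var d n → ℂ) :
    fderiv ℂ (expInt F ρ) z v = ∫ w, expForm F w (fderiv ℂ gramMap z v) *
      (ρ w * Complex.exp (expForm F w (gramMap z))) := by
  obtain ⟨r, hr, h⟩ := integrable_exp_bound hρ hz
  obtain ⟨h1, h2⟩ := hasFPowerSeries_integral_cexp
    (continuous_expForm F).aestronglyMeasurable hρ.1.aestronglyMeasurable _ hr h
  rw [← h2]
  have := (h1.differentiableAt.hasFDerivAt.comp z (differentiable_gramMap z).hasFDerivAt).fderiv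
  exact congrArg (fun l : (Var d n → ℂ) →L[ℂ] ℂ => l v) this

theorem fderiv_expInt_inr {F : Finset (Fin n)} {ρ : EuclideanSpace ℝ F → ℂ} (hρ : Moderate ρ)
    {z : Var d n → ℂ} (hz : gramMap z ∈ goodSet F) (k : Fin n) :
    fderiv ℂ (expInt F ρ) z (Pi.single (Sum.inr k) 1) =
      expInt F (fun w => expVar F w k * ρ w) z := by
  rw [fderiv_expInt hρ hz, expInt, fderiv_gramMap]
  congr 1
  funext w
  rw [expForm_apply]
  simp [Pi.single_apply]
  ring

theorem fderiv_expInt_inl {F : Finset (Fin n)} {ρ : EuclideanSpace ℝ F → ℂ} (hρ : Moderate ρ)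
    {z : Var d n → ℂ} (hz : gramMap z ∈ goodSet F) (i : Fin d) (j : Fin n) :
    fderiv ℂ (expInt F ρ) z (Pi.single (Sum.inl (i, j)) 1) =
      ∑ k, z (Sum.inl (i, k)) * expInt F (fun w => expVar F w k * (expVar F w j * ρ w)) z := by
  rw [fderiv_expInt hρ hz, fderiv_gramMap]
  simp only [expInt, ← integral_const_mul]
  rw [← integral_finsetSum _ fun k _ => (integrable_mul_cexp
    ((moderate_expVar F k).mul ((moderate_expVar F j).mul hρ)) hz).const_mul _]
  congr 1
  funext w
  have h1 : ∀ k l : Fin n, ∑ x : Fin d, (z (Sum.inl (x, k)) *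
      (Pi.single (Sum.inl (i, j)) 1 : Var d n → ℂ) (Sum.inl (x, l)) + z (Sum.inl (x, l)) *
      (Pi.single (Sum.inl (i, j)) 1 : Var d n → ℂ) (Sum.inl (x, k))) =
      (if l = j then z (Sum.inl (i, k)) else 0) + if k = j then z (Sum.inl (i, l)) else 0 := by
    intro k l
    rw [Finset.sum_add_distrib]
    congr 1
    · by_cases h : l = j <;> simp [Pi.single_apply, h]
    · by_cases h : k = j <;> simp [Pi.single_apply, h]
  rw [expForm_apply]
  simp only [Sum.elim_inl, Sum.elim_inr, h1, mul_add, Finset.sum_add_distrib, mul_ite, mul_zero,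
    Finset.sum_ite_eq', Finset.mem_univ, if_true]
  have h2 : ∑ k, ∑ l, (if k = j then 1 / 2 * (expVar F w k * expVar F w l) * z (Sum.inl (i, l))
      else 0) = ∑ l, 1 / 2 * (expVar F w j * expVar F w l) * z (Sum.inl (i, l)) := by
    rw [Finset.sum_comm]
    simp
  rw [h2]
  simp only [ne_eq, reduceCtorEq, not_false_eq_true, Pi.single_eq_of_ne, mul_zero,
    Finset.sum_const_zero, zero_add, ← Finset.sum_add_distrib, Finset.sum_mul]
  refine Finset.sum_congr rfl fun k _ => ?_
  ring

theorem goodSet_of_inl_eq {F : Finset (Fin n)} {c c' : Var n n → ℂ} (hc : c ∈ goodSet F)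
    (h : ∀ q, c' (Sum.inl q) = c (Sum.inl q)) : c' ∈ goodSet F := by
  obtain ⟨ε, hε, C, hC⟩ := hc
  set M : ℝ := ∑ k, 8 * ‖c' (Sum.inr k) - c (Sum.inr k)‖ with hM
  have hM0 : 0 ≤ M := Finset.sum_nonneg fun k _ => by positivity
  refine ⟨ε / 2, by positivity, C + M + M ^ 2 / (2 * ε), fun w => ?_⟩
  have h1 : (expForm F w c').re - (expForm F w c).re ≤ M * (1 + ‖w‖) := by
    rw [← Complex.sub_re]
    refine (Complex.re_le_norm _).trans ?_
    have : expForm F w c' - expForm F w c =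
        ∑ k, expVar F w k * (c' (Sum.inr k) - c (Sum.inr k)) := by
      simp only [expForm_apply, h, mul_sub, Finset.sum_sub_distrib]
      ring
    rw [this, hM, Finset.sum_mul]
    refine norm_sum_le_of_le _ fun k _ => ?_
    rw [norm_mul]
    nlinarith [norm_expVar_le F w k, norm_nonneg (c' (Sum.inr k) - c (Sum.inr k))]
  have h2 : M * ‖w‖ ≤ ε / 2 * ‖w‖ ^ 2 + M ^ 2 / (2 * ε) := by
    have : ε / 2 * ‖w‖ ^ 2 + M ^ 2 / (2 * ε) - M * ‖w‖ = (ε * ‖w‖ - M) ^ 2 / (2 * ε) := by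
      field_simp; ring
    have h4 : 0 ≤ (ε * ‖w‖ - M) ^ 2 / (2 * ε) := by positivity
    linarith
  have := hC w
  linarith

/-- The linear combination of the columns of `a` with index in `F`. -/
def colMap (F : Finset (Fin n)) (q : Var d n → ℝ) : EuclideanSpace ℝ F →ₗ[ℝ] Fin d → ℝ where
  toFun w i := ∑ k : F, q (Sum.inl (i, k)) * w k
  map_add' v w := by
    funext i
    simp [mul_add, Finset.sum_add_distrib]
  map_smul' r w := by
    funext i
    simp [Finset.mul_sum, mul_left_comm]

theorem sum_mul_expVar (F : Finset (Fin n)) (w : EuclideanSpace ℝ F) (f : Fin n → ℂ) :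
    ∑ k, f k * expVar F w k = ∑ k : F, f k * expVar F w k := by
  rw [Finset.sum_coe_sort F fun k => f k * expVar F w k]
  refine (Finset.sum_subset (Finset.subset_univ _) fun k _ hk => ?_).symm
  rw [expVar_of_notMem hk, mul_zero]

theorem sum_mul_expVar_ofReal (F : Finset (Fin n)) (w : EuclideanSpace ℝ F) (f : Fin n → ℝ) :
    ∑ k, (f k : ℂ) * expVar F w k =
      -((∑ k : F, f k : ℝ) : ℂ) + ((2 * Real.pi * ∑ k : F, f k * w k : ℝ) : ℂ) * Complex.I := by
  rw [sum_mul_expVar]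
  push_cast
  rw [Finset.mul_sum, Finset.sum_mul, ← Finset.sum_neg_distrib, ← Finset.sum_add_distrib]
  refine Finset.sum_congr rfl fun k _ => ?_
  rw [expVar_of_mem k.2]
  ring

theorem expForm_gramMap_ofReal (F : Finset (Fin n)) (w : EuclideanSpace ℝ F)
    (q : Var d n → ℝ) :
    expForm F w (gramMap fun v => (q v : ℂ)) =
      ((-(∑ k : F, q (Sum.inr k)) + 1 / 2 * ∑ i, (∑ k : F, q (Sum.inl (i, k))) ^ 2 -
        2 * Real.pi ^ 2 * ∑ i, colMap F q w i ^ 2 : ℝ) : ℂ) +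
      ((2 * Real.pi * (∑ k : F, q (Sum.inr k) * w k -
        ∑ i, (∑ k : F, q (Sum.inl (i, k))) * colMap F q w i) : ℝ) : ℂ) * Complex.I := by
  have h1 : ∀ i, (∑ k, (q (Sum.inl (i, k)) : ℂ) * expVar F w k) ^ 2 =
      (((∑ k : F, q (Sum.inl (i, k))) ^ 2 - 4 * Real.pi ^ 2 * colMap F q w i ^ 2 : ℝ) : ℂ) -
      ((4 * Real.pi * ((∑ k : F, q (Sum.inl (i, k))) * colMap F q w i) : ℝ) : ℂ) *
        Complex.I := by
    intro i
    have : colMap F q w i = ∑ k : F, q (Sum.inl (i, k)) * w k := rfl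
    rw [sum_mul_expVar_ofReal F w fun k => q (Sum.inl (i, k)), ← this, add_sq, mul_pow,
      Complex.I_sq]
    push_cast
    ring
  rw [expForm_gramMap]
  simp_rw [h1, mul_comm (expVar F w _)]
  rw [sum_mul_expVar_ofReal F w fun k => q (Sum.inr k), Finset.sum_sub_distrib, ← Finset.sum_mul,
    ← Complex.ofReal_sum, ← Complex.ofReal_sum, Finset.sum_sub_distrib, ← Finset.mul_sum,
    ← Finset.mul_sum]
  push_cast
  ring

theorem gramMap_ofReal_mem_goodSet_iff (F : Finset (Fin n)) (q : Var d n → ℝ) :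
    gramMap (fun v => (q v : ℂ)) ∈ goodSet F ↔ Function.Injective (colMap F q) := by
  have hre : ∀ w, (expForm F w (gramMap fun v => (q v : ℂ))).re =
      -(∑ k : F, q (Sum.inr k)) + 1 / 2 * ∑ i, (∑ k : F, q (Sum.inl (i, k))) ^ 2 -
        2 * Real.pi ^ 2 * ∑ i, colMap F q w i ^ 2 := by
    intro w
    rw [expForm_gramMap_ofReal, Complex.add_re, Complex.ofReal_re, Complex.re_ofReal_mul,
      Complex.I_re, mul_zero, add_zero]
  constructor
  · rintro ⟨ε, hε, C, h⟩
    rw [injective_iff_map_eq_zero]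
    intro w hw
    by_contra hne
    have hpos : 0 < ‖w‖ := norm_pos_iff.2 hne
    set C0 := -(∑ k : F, q (Sum.inr k)) + 1 / 2 * ∑ i, (∑ k : F, q (Sum.inl (i, k))) ^ 2
    have h1 : ∀ t : ℝ, C0 ≤ C - ε * (t ^ 2 * ‖w‖ ^ 2) := by
      intro t
      have := h (t • w)
      rw [hre, map_smul, hw, norm_smul, mul_pow, Real.norm_eq_abs, sq_abs] at this
      simpa using this
    obtain ⟨m, hm⟩ := exists_nat_gt ((C - C0) / (ε * ‖w‖ ^ 2))
    rw [div_lt_iff₀ (by positivity)] at hm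
    have h2 := h1 (m + 1)
    have h3 : (m : ℝ) ≤ ((m : ℝ) + 1) ^ 2 := by nlinarith [(Nat.cast_nonneg m : (0 : ℝ) ≤ m)]
    have h4 : (m : ℝ) * (ε * ‖w‖ ^ 2) ≤ ((m : ℝ) + 1) ^ 2 * (ε * ‖w‖ ^ 2) := by gcongr
    nlinarith
  · intro hinj
    obtain ⟨K, hK, hanti⟩ := LinearMap.exists_antilipschitzWith
      ((WithLp.linearEquiv 2 ℝ (Fin d → ℝ)).symm.toLinearMap ∘ₗ colMap F q)
      (LinearMap.ker_eq_bot.2 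
        ((WithLp.linearEquiv 2 ℝ (Fin d → ℝ)).symm.injective.comp hinj))
    have hlow : ∀ w, ‖w‖ ^ 2 ≤ (K : ℝ) ^ 2 * ∑ i, colMap F q w i ^ 2 := by
      intro w
      have h1 : ‖w‖ ≤ K * ‖WithLp.toLp 2 (colMap F q w)‖ := by
        simpa [dist_eq_norm] using hanti.le_mul_dist w 0
      have h2 : ‖WithLp.toLp 2 (colMap F q w)‖ ^ 2 = ∑ i, colMap F q w i ^ 2 := by
        rw [EuclideanSpace.real_norm_sq_eq]
      rw [← h2, ← mul_pow]
      exact pow_le_pow_left₀ (norm_nonneg _) h1 2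
    refine ⟨2 * Real.pi ^ 2 / (K : ℝ) ^ 2, by positivity,
      -(∑ k : F, q (Sum.inr k)) + 1 / 2 * ∑ i, (∑ k : F, q (Sum.inl (i, k))) ^ 2, fun w => ?_⟩
    rw [hre]
    refine sub_le_sub_left ?_ _
    have hK' : (0 : ℝ) < (K : ℝ) ^ 2 := by positivity
    rw [div_mul_eq_mul_div, div_le_iff₀ hK']
    nlinarith [hlow w, sq_nonneg Real.pi]

theorem det_gramMatrix_ne_zero_iff (F : Finset (Fin n)) (q : Var d n → ℝ) :
    (gramMatrix F q).det ≠ 0 ↔ Function.Injective (colMap F q) := by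
  have hmul : ∀ v : F → ℝ, ∀ j : F, (gramMatrix F q).mulVec v j =
      ∑ i, q (Sum.inl (i, j)) * colMap F q (WithLp.toLp 2 v) i := by
    intro v j
    simp only [Matrix.mulVec, dotProduct, gramMatrix, colMap, LinearMap.coe_mk, AddHom.coe_mk,
      Finset.mul_sum, Finset.sum_mul]
    rw [Finset.sum_comm]
    refine Finset.sum_congr rfl fun i _ => Finset.sum_congr rfl fun k _ => ?_
    ring
  rw [injective_iff_map_eq_zero, ← not_iff_not, not_not, ← Matrix.exists_mulVec_eq_zero_iff]
  push Not
  constructor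
  · rintro ⟨v, hv, h⟩
    refine ⟨WithLp.toLp 2 v, ?_, by simpa using hv⟩
    have h0 : ∑ j, v j * (gramMatrix F q).mulVec v j = 0 := by simp [h]
    have h1 : ∑ i, colMap F q (WithLp.toLp 2 v) i ^ 2 = 0 := by
      rw [← h0]
      simp only [hmul, Finset.mul_sum]
      rw [Finset.sum_comm]
      refine Finset.sum_congr rfl fun i _ => ?_
      simp only [← mul_assoc, ← Finset.sum_mul, sq]
      congr 1
      exact Finset.sum_congr rfl fun k _ => mul_comm _ _
    funext i
    have := (Finset.sum_eq_zero_iff_of_nonneg fun i _ => sq_nonneg _).1 h1 i (Finset.mem_univ _)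
    simpa using this
  · rintro ⟨w, hw, h⟩
    refine ⟨WithLp.ofLp w, by simpa using h, ?_⟩
    funext j
    rw [hmul]
    simp [hw]

/-- Integration by parts in the direction `j ∈ F`, against a weight that does not depend on the
coordinate `j`. -/
theorem expInt_integration_by_parts {F : Finset (Fin n)} {ρ : EuclideanSpace ℝ F → ℂ}
    (hρ : Moderate ρ) {z : Var d n → ℂ} (hz : gramMap z ∈ goodSet F) {j : Fin n} (hj : j ∈ F)
    (hinv : ∀ w (t : ℝ), ρ (w + t • EuclideanSpace.single ⟨j, hj⟩ 1) = ρ w) :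
    z (Sum.inr j) * expInt F ρ z + ∑ k, ∑ i : Fin d, z (Sum.inl (i, j)) * z (Sum.inl (i, k)) *
      expInt F (fun w => expVar F w k * ρ w) z = 0 := by
  set e : EuclideanSpace ℝ F := EuclideanSpace.single ⟨j, hj⟩ 1 with he
  set g' : EuclideanSpace ℝ F → ℂ := fun w => (z (Sum.inr j) + ∑ k, ∑ i : Fin d,
    z (Sum.inl (i, j)) * z (Sum.inl (i, k)) * expVar F w k) *
      (ρ w * Complex.exp (expForm F w (gramMap z))) with hg'
  have hint : ∀ k, Integrable fun w => expVar F w k * ρ w *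
      Complex.exp (expForm F w (gramMap z)) := fun k =>
    integrable_mul_cexp ((moderate_expVar F k).mul hρ) hz
  have hint0 := integrable_mul_cexp hρ hz
  have hexp : ∀ w, g' w = z (Sum.inr j) * (ρ w * Complex.exp (expForm F w (gramMap z))) +
      ∑ k, ∑ i : Fin d, z (Sum.inl (i, j)) * z (Sum.inl (i, k)) *
        (expVar F w k * ρ w * Complex.exp (expForm F w (gramMap z))) := by
    intro w
    simp only [hg', add_mul, Finset.sum_mul]
    congr 1
    refine Finset.sum_congr rfl fun k _ => Finset.sum_congr rfl fun i _ => ?_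
    ring
  have hsumint : ∀ k ∈ (Finset.univ : Finset (Fin n)), Integrable fun w =>
      ∑ i : Fin d, z (Sum.inl (i, j)) * z (Sum.inl (i, k)) *
        (expVar F w k * ρ w * Complex.exp (expForm F w (gramMap z))) := fun k _ =>
    integrable_finsetSum _ fun i _ => (hint k).const_mul _
  have hg'int : Integrable g' := by
    rw [show g' = _ from funext hexp]
    exact (hint0.const_mul _).add (integrable_finsetSum _ hsumint)
  have hval : z (Sum.inr j) * expInt F ρ z + ∑ k, ∑ i : Fin d, z (Sum.inl (i, j)) *
      z (Sum.inl (i, k)) * expInt F (fun w => expVar F w k * ρ w) z = ∫ w, g' w := by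
    simp only [hexp]
    rw [integral_add (hint0.const_mul _) (integrable_finsetSum _ hsumint),
      integral_finsetSum _ hsumint, integral_const_mul]
    congr 1
    refine Finset.sum_congr rfl fun k _ => ?_
    rw [integral_finsetSum _ fun i _ => (hint k).const_mul _]
    refine Finset.sum_congr rfl fun i _ => ?_
    rw [integral_const_mul]
    rfl
  rw [hval]
  have hu : ∀ w (t : ℝ) k, expVar F (w + t • e) k =
      expVar F w k + if k = j then 2 * Real.pi * Complex.I * t else 0 := by
    intro w t k
    by_cases hk : k ∈ F
    · rw [expVar_of_mem hk, expVar_of_mem hk]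
      by_cases hkj : k = j
      · subst hkj
        simp [he]
        ring
      · simp [he, hkj]
    · have hkj : k ≠ j := fun h => hk (h ▸ hj)
      simp [expVar_of_notMem hk, hkj]
  have hline : ∀ w, HasLineDerivAt ℝ (fun w => ρ w * Complex.exp (expForm F w (gramMap z)))
      (2 * Real.pi * Complex.I * g' w) w e := by
    intro w
    unfold HasLineDerivAt
    simp only [hinv]
    have hE : HasDerivAt (fun t : ℝ => expForm F (w + t • e) (gramMap z))
        (2 * Real.pi * Complex.I * (z (Sum.inr j) + ∑ k, ∑ i : Fin d,
    z (Sum.inl (i, j)) * z (Sum.inl (i, k)) * expVar F w k)) 0 := by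
      have hlin : ∀ k, HasDerivAt (fun t : ℝ => expVar F (w + t • e) k)
          (if k = j then 2 * Real.pi * Complex.I else 0) 0 := by
        intro k
        simp only [hu]
        by_cases hk : k = j
        · simp only [hk, if_true]
          simpa using ((Complex.ofRealCLM.hasDerivAt (x := 0)).const_mul
            (2 * Real.pi * Complex.I : ℂ)).const_add (expVar F w j)
        · simp only [hk, if_false]
          exact hasDerivAt_const _ _
      simp only [expForm_gramMap]
      have h1 := HasDerivAt.fun_sum (u := Finset.univ) fun k _ =>
        (hlin k).mul_const (z (Sum.inr k))
      have h2 := (HasDerivAt.fun_sum (u := (Finset.univ : Finset (Fin d))) fun i _ =>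
        (HasDerivAt.fun_sum (u := Finset.univ) fun k _ =>
          (hlin k).const_mul (z (Sum.inl (i, k)))).pow 2).const_mul (1 / 2 : ℂ)
      convert! h1.add h2 using 1
      simp only [ite_mul, zero_mul, mul_ite, mul_zero, Finset.sum_ite_eq', Finset.mem_univ,
        if_true, zero_smul, add_zero, Finset.mul_sum, mul_add]
      congr 1
      rw [Finset.sum_comm]
      refine Finset.sum_congr rfl fun i _ => ?_
      simp only [Nat.cast_ofNat, Nat.add_one_sub_one, pow_one, Finset.mul_sum, Finset.sum_mul]
      refine Finset.sum_congr rfl fun k _ => ?_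
      ring
    have := (hE.cexp).const_mul (ρ w)
    refine this.congr_deriv ?_
    simp only [hg', zero_smul, add_zero]
    ring
  have hparts := integral_bilinear_hasLineDerivAt_right_eq_neg_left_of_integrable
    (μ := (volume : Measure (EuclideanSpace ℝ F))) (B := ContinuousLinearMap.mul ℝ ℂ)
    (f := fun _ => (1 : ℂ)) (f' := fun _ => 0) (v := e)
    (g := fun w => ρ w * Complex.exp (expForm F w (gramMap z)))
    (g' := fun w => 2 * Real.pi * Complex.I * g' w) (by simp)
    (by simpa using hg'int.const_mul _) (by simpa using hint0)
    (fun w _ => by simpa using HasFDerivAt.hasLineDerivAt (hasFDerivAt_const (1 : ℂ) w) e)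
    (fun w _ => hline w)
  simp only [ContinuousLinearMap.mul_apply', one_mul, zero_mul, integral_zero, neg_zero,
    integral_const_mul] at hparts
  refine (mul_eq_zero.1 hparts).resolve_left ?_
  simp [Real.pi_ne_zero]

end ExpInt

/-! ### The functions `φ_F` as integrals of exponentials -/

section Fourier

open scoped FourierTransform

theorem integral_euclideanSpace_prod {𝕜 ι : Type*} [RCLike 𝕜] [Fintype ι] (f : ι → ℝ → 𝕜) :
    ∫ β : EuclideanSpace ℝ ι, ∏ k, f k (β k) = ∏ k, ∫ t, f k t := by
  rw [← (PiLp.volume_preserving_toLp ι).integral_comp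
    (MeasurableEquiv.toLp 2 _).measurableEmbedding]
  exact integral_fintype_prod_volume_eq_prod f

theorem integrable_euclideanSpace_prod {ι : Type*} [Fintype ι] {f : ι → ℝ → ℂ}
    (hf : ∀ k, Integrable (f k)) :
    Integrable fun β : EuclideanSpace ℝ ι => ∏ k, f k (β k) := by
  rw [← (PiLp.volume_preserving_toLp ι).integrable_comp_emb
    (MeasurableEquiv.toLp 2 _).measurableEmbedding]
  exact Integrable.fintype_prod hf

theorem measurable_heaviside : Measurable heaviside := by
  unfold heaviside
  exact Measurable.ite measurableSet_Ici measurable_const measurable_const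

theorem heaviside_sub_one_mul (t : ℝ) (l : ℝ) (u : ℂ) :
    ((heaviside (l + t) - 1 : ℝ) : ℂ) * Complex.exp (u * t) =
      (Set.Iio (-l)).indicator (fun t : ℝ => -Complex.exp (u * t)) t := by
  by_cases h : t < -l
  · rw [Set.indicator_of_mem (by exact h), heaviside, if_neg (by linarith)]
    simp
  · rw [Set.indicator_of_notMem (by exact h), heaviside, if_pos (by linarith)]
    simp

theorem integrable_heaviside_mul_cexp {u : ℂ} (hu : 0 < u.re) (l : ℝ) :
    Integrable fun t : ℝ => ((heaviside (l + t) - 1 : ℝ) : ℂ) * Complex.exp (u * t) := by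
  simp only [heaviside_sub_one_mul]
  rw [integrable_indicator_iff measurableSet_Iio]
  exact ((integrableOn_exp_mul_complex_Iic hu _).mono_set Set.Iio_subset_Iic_self).neg

theorem integral_heaviside_mul_cexp {u : ℂ} (hu : 0 < u.re) (l : ℝ) :
    ∫ t : ℝ, ((heaviside (l + t) - 1 : ℝ) : ℂ) * Complex.exp (u * t) =
      -(Complex.exp (-u * l) / u) := by
  simp only [heaviside_sub_one_mul]
  rw [integral_indicator measurableSet_Iio, integral_neg, ← integral_Iic_eq_integral_Iio,
    integral_exp_mul_complex_Iic hu]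
  simp

theorem heaviside_sub_one_mem (t : ℝ) : -1 ≤ heaviside t - 1 ∧ heaviside t - 1 ≤ 0 := by
  unfold heaviside
  split_ifs <;> norm_num

theorem integral_norm_heaviside_mul_cexp {u : ℂ} (hu : u.re = 1) (l : ℝ) :
    ∫ t : ℝ, ‖((heaviside (l + t) - 1 : ℝ) : ℂ) * Complex.exp (u * t)‖ = Real.exp (-l) := by
  have h1 : ∀ t : ℝ, ((‖((heaviside (l + t) - 1 : ℝ) : ℂ) * Complex.exp (u * t)‖ : ℝ) : ℂ) =
      -(((heaviside (l + t) - 1 : ℝ) : ℂ) * Complex.exp (1 * t)) := by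
    intro t
    rw [norm_mul, Complex.norm_exp, Complex.norm_real, Real.norm_of_nonpos
      (heaviside_sub_one_mem _).2, Complex.re_mul_ofReal, hu]
    push_cast
    ring
  apply Complex.ofReal_injective
  rw [← integral_complex_ofReal]
  simp only [h1]
  rw [integral_neg, integral_heaviside_mul_cexp (by simp)]
  simp

theorem continuousAt_heaviside {t : ℝ} (ht : t ≠ 0) : ContinuousAt heaviside t := by
  rcases lt_or_gt_of_ne ht with h | h
  · refine (continuousAt_const (y := (0 : ℝ))).congr ?_
    filter_upwards [Iio_mem_nhds h] with s hs
    rw [heaviside, if_neg (not_le.2 hs)]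
  · refine (continuousAt_const (y := (1 : ℝ))).congr ?_
    filter_upwards [Ioi_mem_nhds h] with s hs
    rw [heaviside, if_pos (le_of_lt hs)]

/-- The density of the standard normal distribution on `ℝ^d`. -/
def gaussDensity {d : ℕ} (x : Fin d → ℝ) : ℝ :=
  1 / (2 * Real.pi) ^ ((d : ℝ) / 2) * Real.exp (-(1 / 2) * ∑ i, x i ^ 2)

theorem gaussDensity_nonneg {d : ℕ} (x : Fin d → ℝ) : 0 ≤ gaussDensity x := by
  unfold gaussDensity
  positivity

theorem continuous_gaussDensity {d : ℕ} : Continuous (gaussDensity (d := d)) := by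
  unfold gaussDensity
  fun_prop

theorem gaussDensity_mul_cexp {d : ℕ} (c : Fin d → ℂ) (x : Fin d → ℝ) :
    (gaussDensity x : ℂ) * Complex.exp (∑ i, c i * x i) =
      ((1 / (2 * Real.pi) ^ ((d : ℝ) / 2) : ℝ) : ℂ) *
        Complex.exp (-∑ i, (1 / 2 : ℂ) * (x i : ℂ) ^ 2 + ∑ i, c i * x i) := by
  rw [gaussDensity, Complex.exp_add, ← Finset.mul_sum]
  push_cast
  simp only [neg_mul]
  ring

theorem integrable_gaussDensity_mul_cexp {d : ℕ} (c : Fin d → ℂ) :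
    Integrable fun x : Fin d → ℝ => (gaussDensity x : ℂ) * Complex.exp (∑ i, c i * x i) := by
  simp only [gaussDensity_mul_cexp]
  exact (GaussianFourier.integrable_cexp_neg_sum_mul_add (b := fun _ => (1 / 2 : ℂ))
    (fun _ => by norm_num) c).const_mul _

theorem integral_gaussDensity_mul_cexp {d : ℕ} (c : Fin d → ℂ) :
    ∫ x : Fin d → ℝ, (gaussDensity x : ℂ) * Complex.exp (∑ i, c i * x i) =
      Complex.exp (1 / 2 * ∑ i, c i ^ 2) := by
  simp only [gaussDensity_mul_cexp]
  rw [integral_const_mul, GaussianFourier.integral_cexp_neg_sum_mul_add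
    (b := fun _ => (1 / 2 : ℂ)) (fun _ => by norm_num) c, Finset.prod_mul_distrib,
    Finset.prod_const, Finset.card_univ, Fintype.card_fin, ← mul_assoc]
  have h1 : ((1 / (2 * Real.pi) ^ ((d : ℝ) / 2) : ℝ) : ℂ) *
      (((Real.pi : ℂ) / (1 / 2)) ^ (1 / 2 : ℂ)) ^ d = 1 := by
    have h2 : ((Real.pi : ℂ) / (1 / 2)) ^ (1 / 2 : ℂ) =
        (((2 * Real.pi) ^ (1 / 2 : ℝ) : ℝ) : ℂ) := by
      rw [Complex.ofReal_cpow (by positivity)]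
      congr 1 <;> push_cast <;> ring
    rw [h2, ← Complex.ofReal_pow, ← Complex.ofReal_mul, ← Real.rpow_mul_natCast (by positivity),
      show (1 / 2 : ℝ) * d = d / 2 by ring, one_div_mul_cancel (by positivity), Complex.ofReal_one]
  rw [h1, one_mul, ← Complex.exp_sum, Finset.mul_sum]
  congr 1
  refine Finset.sum_congr rfl fun i _ => ?_
  ring

theorem integrable_gaussDensity {d : ℕ} : Integrable (gaussDensity (d := d)) := by
  have := (integrable_gaussDensity_mul_cexp (d := d) 0).norm
  refine this.congr (ae_of_all _ fun x => ?_)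
  simp [abs_of_nonneg (gaussDensity_nonneg x)]

theorem integral_gaussDensity {d : ℕ} : ∫ x : Fin d → ℝ, gaussDensity x = 1 := by
  apply Complex.ofReal_injective
  rw [← integral_complex_ofReal]
  simpa using integral_gaussDensity_mul_cexp (d := d) 0

variable {d n : ℕ}

theorem volume_setOf_affine_eq_zero {l : (Fin d → ℝ) →ₗ[ℝ] ℝ} (hl : l ≠ 0) (b : ℝ) :
    volume {x | l x + b = 0} = 0 := by
  obtain ⟨x0, hx0⟩ := LinearMap.surjective hl (-b)
  have h1 : {x | l x + b = 0} = (fun x => x + -x0) ⁻¹' (LinearMap.ker l : Set (Fin d → ℝ)) := by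
    ext x
    simp [hx0, ← sub_eq_add_neg]
  rw [h1, measure_preimage_add_right]
  exact Measure.addHaar_submodule _ _ fun h => hl (LinearMap.ker_eq_top.1 h)

/-- The weight that represents the product of the functions `H - 1`. -/
def baseWeight (F : Finset (Fin n)) (w : EuclideanSpace ℝ F) : ℂ := ∏ k ∈ F, (expVar F w k)⁻¹

theorem moderate_prod_inv {F G : Finset (Fin n)} (hG : G ⊆ F) :
    Moderate fun w => ∏ k ∈ G, (expVar F w k)⁻¹ := by
  refine Moderate.of_bounded (continuous_finsetProd _ fun k hk =>
    (continuous_expVar F k).inv₀ fun w => expVar_ne_zero (hG hk) w) (C := 1) fun w => ?_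
  rw [norm_prod]
  refine Finset.prod_le_one (fun _ _ => norm_nonneg _) fun k hk => ?_
  rw [norm_inv]
  exact inv_le_one_of_one_le₀ (one_le_norm_expVar (hG hk) w)

theorem moderate_baseWeight (F : Finset (Fin n)) : Moderate (baseWeight F) :=
  moderate_prod_inv subset_rfl

/-- The linear part of `f_j`. -/
def colForm (q : Var d n → ℝ) (j : Fin n) : (Fin d → ℝ) →ₗ[ℝ] ℝ :=
  ∑ i, q (Sum.inl (i, j)) • LinearMap.proj i

theorem colForm_apply (q : Var d n → ℝ) (j : Fin n) (x : Fin d → ℝ) :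
    colForm q j x = ∑ i, q (Sum.inl (i, j)) * x i := by
  simp [colForm]

theorem phi_eq (F : Finset (Fin n)) (q : Var d n → ℝ) :
    phi F q = ∫ x, gaussDensity x * ∏ k : F, (heaviside (colForm q k x + q (Sum.inr k)) - 1) := by
  unfold phi
  congr 1
  funext x
  rw [Finset.prod_coe_sort F fun k => heaviside (colForm q k x + q (Sum.inr k)) - 1]
  simp only [colForm_apply, affForm, gaussDensity]

theorem colForm_ne_zero {F : Finset (Fin n)} {q : Var d n → ℝ}
    (h : Function.Injective (colMap F q)) (k : F) : colForm q k ≠ 0 := by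
  intro h0
  have h1 : colMap F q (EuclideanSpace.single k 1) = 0 := by
    funext i
    have := LinearMap.congr_fun h0 (Pi.single i 1)
    rw [colForm_apply] at this
    simpa [colMap, Pi.single_apply] using this
  have := (injective_iff_map_eq_zero _).1 h _ h1
  simpa using congrArg (fun v : EuclideanSpace ℝ F => v k) this

/-- `φ_F` with an exponential factor, as a function of `b`. -/
def twistedPhi (F : Finset (Fin n)) (q : Var d n → ℝ) (β : EuclideanSpace ℝ F) : ℂ :=
  ∫ x, (gaussDensity x : ℂ) *
    ∏ k : F, (((heaviside (colForm q k x + β k) - 1 : ℝ) : ℂ) * Complex.exp (1 * (β k : ℂ)))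

theorem twistedPhi_eq (F : Finset (Fin n)) (q : Var d n → ℝ) :
    twistedPhi F q (WithLp.toLp 2 fun k : F => q (Sum.inr k)) =
      (phi F q : ℂ) * Complex.exp (∑ k : F, (q (Sum.inr k) : ℂ)) := by
  rw [phi_eq, ← integral_complex_ofReal, ← integral_mul_const, twistedPhi]
  congr 1
  funext x
  rw [Finset.prod_mul_distrib, Complex.exp_sum]
  push_cast
  simp only [one_mul]
  ring

theorem continuousAt_twistedPhi {F : Finset (Fin n)} {q : Var d n → ℝ}
    (h : Function.Injective (colMap F q)) (β : EuclideanSpace ℝ F) :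
    ContinuousAt (twistedPhi F q) β := by
  have hfac : ∀ β', twistedPhi F q β' = (∫ x, ((gaussDensity x * ∏ k : F,
      (heaviside (colForm q k x + β' k) - 1) : ℝ) : ℂ)) * Complex.exp (∑ k : F, (β' k : ℂ)) := by
    intro β'
    rw [← integral_mul_const, twistedPhi]
    congr 1
    funext x
    rw [Finset.prod_mul_distrib, Complex.exp_sum]
    push_cast
    simp only [one_mul]
    ring
  rw [show twistedPhi F q = _ from funext hfac]
  refine ContinuousAt.mul ?_ (by fun_prop)
  refine continuousAt_of_dominated (bound := gaussDensity)
    (Filter.Eventually.of_forall fun β' => ?_)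
    (Filter.Eventually.of_forall fun β' => ae_of_all _ fun x => ?_) integrable_gaussDensity ?_
  · refine (Measurable.aestronglyMeasurable ?_)
    have := measurable_heaviside
    have := continuous_gaussDensity (d := d)
    simp only [colForm_apply]
    fun_prop
  · rw [Complex.norm_real, norm_mul, Real.norm_of_nonneg (gaussDensity_nonneg x), norm_prod]
    refine mul_le_of_le_one_right (gaussDensity_nonneg x) (Finset.prod_le_one
      (fun _ _ => norm_nonneg _) fun k _ => ?_)
    obtain ⟨h1, h2⟩ := heaviside_sub_one_mem (colForm q k x + β' k)
    rw [Real.norm_eq_abs, abs_le]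
    constructor <;> linarith
  · have hae : ∀ᵐ x : Fin d → ℝ, ∀ k : F, colForm q k x + β k ≠ 0 := by
      rw [ae_all_iff]
      intro k
      rw [ae_iff]
      simpa using volume_setOf_affine_eq_zero (colForm_ne_zero h k) (β k)
    filter_upwards [hae] with x hx
    refine Complex.continuous_ofReal.continuousAt.comp (continuousAt_const.mul ?_)
    refine tendsto_finsetProd _ fun k _ => ?_
    refine Filter.Tendsto.sub_const ?_ _
    exact ContinuousAt.comp (f := fun β' : EuclideanSpace ℝ F => colForm q k x + β' k)
      (continuousAt_heaviside (hx k)) (by fun_prop)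

/-- The integrand of the Fourier transform of `twistedPhi`. -/
def jointIntegrand (F : Finset (Fin n)) (q : Var d n → ℝ) (w : EuclideanSpace ℝ F)
    (v : EuclideanSpace ℝ F × (Fin d → ℝ)) : ℂ :=
  (gaussDensity v.2 : ℂ) * ∏ k : F, (((heaviside (colForm q k v.2 + v.1 k) - 1 : ℝ) : ℂ) *
    Complex.exp (-expVar F w k * (v.1 k : ℂ)))

theorem measurable_jointIntegrand (F : Finset (Fin n)) (q : Var d n → ℝ)
    (w : EuclideanSpace ℝ F) : Measurable (jointIntegrand F q w) := by
  have := measurable_heaviside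
  have := continuous_gaussDensity (d := d)
  unfold jointIntegrand
  simp only [colForm_apply]
  fun_prop

theorem re_neg_expVar {F : Finset (Fin n)} (w : EuclideanSpace ℝ F) (k : F) :
    (-expVar F w k).re = 1 := by
  simp [expVar_of_mem k.2]

theorem integrable_jointIntegrand (F : Finset (Fin n)) (q : Var d n → ℝ)
    (w : EuclideanSpace ℝ F) :
    Integrable (jointIntegrand F q w) ((volume : Measure (EuclideanSpace ℝ F)).prod volume) := by
  rw [integrable_prod_iff' (measurable_jointIntegrand F q w).aestronglyMeasurable]
  have hk : ∀ k : F, 0 < (-expVar F w k).re := fun k => by rw [re_neg_expVar]; norm_num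
  refine ⟨ae_of_all _ fun x => ?_, ?_⟩
  · exact (integrable_euclideanSpace_prod fun k : F =>
      integrable_heaviside_mul_cexp (hk k) (colForm q k x)).const_mul (gaussDensity x : ℂ)
  · have h1 : ∀ x : Fin d → ℝ, ∫ β, ‖jointIntegrand F q w (β, x)‖ =
        ‖(gaussDensity x : ℂ) * Complex.exp (∑ i, (-∑ k : F, (q (Sum.inl (i, k)) : ℂ)) * x i)‖ := by
      intro x
      simp only [jointIntegrand, norm_mul, norm_prod]
      rw [integral_const_mul]
      congr 1
      refine (integral_euclideanSpace_prod fun (k : F) (t : ℝ) =>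
        ‖((heaviside (colForm q k x + t) - 1 : ℝ) : ℂ)‖ *
          ‖Complex.exp (-expVar F w k * (t : ℂ))‖).trans ?_
      simp only [← norm_mul]
      rw [Finset.prod_congr rfl fun k _ =>
        integral_norm_heaviside_mul_cexp (re_neg_expVar w k) (colForm q k x), ← Real.exp_sum,
        Complex.norm_exp]
      congr 1
      rw [← Complex.ofReal_re (∑ k : F, -colForm q k x)]
      congr 1
      simp only [colForm_apply]
      push_cast
      simp only [← Finset.sum_neg_distrib, Finset.sum_mul]
      rw [Finset.sum_comm]
      simp
    simp only [h1]
    exact (integrable_gaussDensity_mul_cexp _).norm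

theorem fourier_twistedPhi (F : Finset (Fin n)) (q : Var d n → ℝ) (w : EuclideanSpace ℝ F) :
    𝓕 (twistedPhi F q) w = baseWeight F w * Complex.exp (1 / 2 * ∑ i : Fin d,
      (∑ k, (q (Sum.inl (i, k)) : ℂ) * expVar F w k) ^ 2) := by
  have hk : ∀ k : F, 0 < (-expVar F w k).re := fun k => by rw [re_neg_expVar]; norm_num
  have h1 : 𝓕 (twistedPhi F q) w = ∫ β, ∫ x, jointIntegrand F q w (β, x) := by
    rw [Real.fourier_eq']
    congr 1
    funext β
    rw [smul_eq_mul, twistedPhi, ← integral_const_mul]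
    congr 1
    funext x
    have h2 : Complex.exp (((-2 * Real.pi * inner ℝ β w : ℝ) : ℂ) * Complex.I) =
        ∏ k : F, Complex.exp (-2 * Real.pi * (β k) * (w k) * Complex.I) := by
      rw [← Complex.exp_sum, ← Finset.sum_mul]
      congr 2
      rw [PiLp.inner_apply, Finset.mul_sum]
      push_cast
      refine Finset.sum_congr rfl fun k _ => ?_
      simp
      ring
    rw [h2, mul_left_comm, ← Finset.prod_mul_distrib, jointIntegrand]
    congr 1
    refine Finset.prod_congr rfl fun k _ => ?_
    rw [mul_left_comm, ← Complex.exp_add, expVar_of_mem k.2]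
    congr 2
    ring
  have h3 : ∀ x, ∫ β, jointIntegrand F q w (β, x) = baseWeight F w *
      ((gaussDensity x : ℂ) * Complex.exp (∑ i, (∑ k, (q (Sum.inl (i, k)) : ℂ) * expVar F w k) *
        x i)) := by
    intro x
    simp only [jointIntegrand]
    rw [integral_const_mul, mul_left_comm]
    congr 1
    refine (integral_euclideanSpace_prod fun (k : F) (t : ℝ) =>
      ((heaviside (colForm q k x + t) - 1 : ℝ) : ℂ) *
        Complex.exp (-expVar F w k * (t : ℂ))).trans ?_
    rw [Finset.prod_congr rfl fun k _ => integral_heaviside_mul_cexp (hk k) (colForm q k x)]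
    have h4 : ∑ i, (∑ k, (q (Sum.inl (i, k)) : ℂ) * expVar F w k) * x i =
        ∑ k : F, expVar F w k * (colForm q k x : ℂ) := by
      simp only [sum_mul_expVar, colForm_apply]
      push_cast
      simp only [Finset.sum_mul, Finset.mul_sum]
      rw [Finset.sum_comm]
      refine Finset.sum_congr rfl fun k _ => Finset.sum_congr rfl fun i _ => ?_
      ring
    rw [h4, Complex.exp_sum, baseWeight, ← Finset.prod_coe_sort F fun k => (expVar F w k)⁻¹,
      ← Finset.prod_mul_distrib]
    refine Finset.prod_congr rfl fun k _ => ?_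
    rw [neg_neg, div_neg, neg_neg, div_eq_inv_mul]
  rw [h1, integral_integral_swap (f := fun β x => jointIntegrand F q w (β, x))
    (integrable_jointIntegrand F q w)]
  simp only [h3]
  rw [integral_const_mul, integral_gaussDensity_mul_cexp]

/-- The function `φ_F` as an integral of exponentials, by Fourier inversion. -/
theorem expInt_baseWeight_ofReal {F : Finset (Fin n)} {q : Var d n → ℝ}
    (h : Function.Injective (colMap F q)) :
    expInt F (baseWeight F) (fun v => (q v : ℂ)) = (phi F q : ℂ) := by
  set q0 : Var d n → ℝ := Sum.elim (fun v => q (Sum.inl v)) fun _ => 0 with hq0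
  have hfour : 𝓕 (twistedPhi F q) = fun w =>
      baseWeight F w * Complex.exp (expForm F w (gramMap fun v => (q0 v : ℂ))) := by
    funext w
    rw [fourier_twistedPhi, expForm_gramMap]
    simp [hq0]
  have hint : Integrable (𝓕 (twistedPhi F q)) := by
    rw [hfour]
    exact integrable_mul_cexp (moderate_baseWeight F)
      ((gramMap_ofReal_mem_goodSet_iff F q0).2 h)
  have hint0 : Integrable (twistedPhi F q) := by
    refine ((integrable_jointIntegrand F q 0).integral_prod_left).congr (ae_of_all _ fun β => ?_)
    simp only [twistedPhi, jointIntegrand]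
    congr 1
    funext x
    congr 1
    refine Finset.prod_congr rfl fun k _ => ?_
    simp [expVar_of_mem k.2]
  have hinv := hint0.fourierInv_fourier_eq hint
    (continuousAt_twistedPhi h (WithLp.toLp 2 fun k : F => q (Sum.inr k)))
  rw [twistedPhi_eq, Real.fourierInv_eq', hfour] at hinv
  rw [eq_comm, ← eq_div_iff (Complex.exp_ne_zero _)] at hinv
  rw [hinv, expInt, eq_div_iff (Complex.exp_ne_zero _), ← integral_mul_const]
  congr 1
  funext w
  rw [smul_eq_mul, mul_left_comm, mul_assoc]
  congr 1
  rw [← Complex.exp_add, ← Complex.exp_add, expForm_gramMap, expForm_gramMap]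
  congr 1
  simp only [hq0, Sum.elim_inl, Sum.elim_inr, mul_comm (expVar F w _), sum_mul_expVar]
  rw [PiLp.inner_apply]
  push_cast
  simp only [zero_mul, Finset.sum_const_zero, zero_add]
  rw [add_right_comm, ← Finset.sum_add_distrib]
  congr 1
  rw [Finset.mul_sum, Finset.sum_mul]
  refine Finset.sum_congr rfl fun k _ => ?_
  rw [expVar_of_mem k.2]
  simp
  ring

end Fourier

/-! ### Analyticity and linear independence of the functions `φ_F` -/

section Real

variable {d n : ℕ}

/-- The inclusion of the real points. -/
def ofRealVar (d n : ℕ) : (Var d n → ℝ) →L[ℝ] (Var d n → ℂ) :=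
  ContinuousLinearMap.pi fun v => Complex.ofRealCLM.comp (ContinuousLinearMap.proj v)

theorem analyticAt_expInt_ofReal {F : Finset (Fin n)} {q : Var d n → ℝ}
    (h : Function.Injective (colMap F q)) :
    AnalyticAt ℝ (fun q : Var d n → ℝ => expInt F (baseWeight F) (fun v => (q v : ℂ))) q := by
  have h1 := (analyticAt_expInt (moderate_baseWeight F)
    ((gramMap_ofReal_mem_goodSet_iff F q).2 h)).restrictScalars (𝕜 := ℝ)
  exact AnalyticAt.comp (f := ofRealVar d n) h1 ((ofRealVar d n).analyticAt q)

theorem eventually_injective_colMap {F : Finset (Fin n)} {q : Var d n → ℝ}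
    (h : Function.Injective (colMap F q)) :
    ∀ᶠ q' in 𝓝 q, Function.Injective (colMap F q') := by
  have hc : Continuous fun q : Var d n → ℝ => gramMap (ofRealVar d n q) :=
    differentiable_gramMap.continuous.comp (ofRealVar d n).continuous
  filter_upwards [((isOpen_goodSet F).preimage hc).mem_nhds
    ((gramMap_ofReal_mem_goodSet_iff F q).2 h)] with q' hq'
  exact (gramMap_ofReal_mem_goodSet_iff F q').1 hq'

theorem analyticAt_phi {F : Finset (Fin n)} {q : Var d n → ℝ}
    (h : Function.Injective (colMap F q)) : AnalyticAt ℝ (phi F) q := by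
  refine (AnalyticAt.comp (f := fun q : Var d n → ℝ => expInt F (baseWeight F)
    (fun v => (q v : ℂ))) (Complex.reCLM.analyticAt _) (analyticAt_expInt_ofReal h)).congr ?_
  filter_upwards [eventually_injective_colMap h] with q' hq'
  simp [expInt_baseWeight_ofReal hq']

theorem tendsto_phi (F J : Finset (Fin n)) (a : Fin d × Fin n → ℝ) :
    Filter.Tendsto (fun t : ℝ => phi F (Sum.elim a fun j => if j ∈ J then -t else t))
      Filter.atTop (𝓝 (∏ k ∈ F, if k ∈ J then -1 else 0)) := by
  have hlim : ∏ k ∈ F, (if k ∈ J then (-1 : ℝ) else 0) =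
      ∫ x : Fin d → ℝ, gaussDensity x * ∏ k ∈ F, if k ∈ J then (-1 : ℝ) else 0 := by
    rw [integral_mul_const, integral_gaussDensity, one_mul]
  rw [hlim]
  unfold phi
  refine tendsto_integral_filter_of_dominated_convergence gaussDensity
    (Filter.Eventually.of_forall fun t => ?_)
    (Filter.Eventually.of_forall fun t => ae_of_all _ fun x => ?_) integrable_gaussDensity
    (ae_of_all _ fun x => ?_)
  · refine (Measurable.aestronglyMeasurable ?_)
    have := measurable_heaviside
    unfold affForm
    fun_prop
  · change ‖gaussDensity x * _‖ ≤ _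
    rw [norm_mul, Real.norm_of_nonneg (gaussDensity_nonneg x), norm_prod]
    refine mul_le_of_le_one_right (gaussDensity_nonneg x) (Finset.prod_le_one
      (fun _ _ => norm_nonneg _) fun k _ => ?_)
    obtain ⟨h1, h2⟩ := heaviside_sub_one_mem
      (affForm (Sum.elim a fun j => if j ∈ J then -t else t) k x)
    rw [Real.norm_eq_abs, abs_le]
    constructor <;> linarith
  · refine Filter.Tendsto.const_mul _ (tendsto_finsetProd _ fun k _ => ?_)
    refine tendsto_const_nhds.congr' ?_
    filter_upwards [Filter.eventually_gt_atTop |∑ i, a (i, k) * x i|] with t ht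
    simp only [affForm, Sum.elim_inl, Sum.elim_inr]
    by_cases hk : k ∈ J
    · rw [if_pos hk, if_pos hk, heaviside, if_neg (by linarith [le_abs_self (∑ i, a (i, k) * x i)])]
      norm_num
    · rw [if_neg hk, if_neg hk, heaviside, if_pos (by linarith [neg_abs_le (∑ i, a (i, k) * x i)])]
      norm_num

/-- The functions `φ_F` with independent columns are linearly independent near every point. -/
theorem coeff_eq_zero_of_eventually_sum_phi_eq_zero {q : Var d n → ℝ}
    (S : Finset (Finset (Fin n))) (hS : ∀ F ∈ S, Function.Injective (colMap F q))
    (c : Finset (Fin n) → ℂ)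
    (h : ∀ᶠ q' in 𝓝 q, ∑ F ∈ S, c F * ((phi F q' : ℝ) : ℂ) = 0) : ∀ F ∈ S, c F = 0 := by
  set a : Fin d × Fin n → ℝ := fun v => q (Sum.inl v) with ha
  set ι : (Fin n → ℝ) → Var d n → ℝ := fun b => Sum.elim a b with hι
  have hinj : ∀ F ∈ S, ∀ b, Function.Injective (colMap F (ι b)) := fun F hF b => hS F hF
  have hιa : ∀ b, AnalyticAt ℝ ι b := by
    intro b
    rw [analyticAt_pi_iff]
    rintro (v | v)
    · exact analyticAt_const
    · exact (ContinuousLinearMap.proj (R := ℝ) (φ := fun _ : Fin n => ℝ) v).analyticAt b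
  have han : AnalyticOnNhd ℝ (fun b => ∑ F ∈ S, c F * ((phi F (ι b) : ℝ) : ℂ)) Set.univ := by
    intro b _
    refine Finset.analyticAt_fun_sum _ fun F hF => analyticAt_const.mul ?_
    exact (Complex.ofRealCLM.analyticAt _).comp
      ((analyticAt_phi (hinj F hF b)).comp (f := ι) (hιa b))
  have hq : ι (fun j => q (Sum.inr j)) = q := by
    funext v
    rcases v with v | v <;> rfl
  have hzero : ∀ b, ∑ F ∈ S, c F * ((phi F (ι b) : ℝ) : ℂ) = 0 := by
    intro b
    refine han.eqOn_zero_of_preconnected_of_eventuallyEq_zero isPreconnected_univ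
      (Set.mem_univ fun j => q (Sum.inr j)) ?_ (Set.mem_univ b)
    have := (hιa fun j => q (Sum.inr j)).continuousAt
    rw [ContinuousAt, hq] at this
    exact this.eventually h
  have hrel : ∀ J : Finset (Fin n),
      ∑ F ∈ S, c F * (∏ k ∈ F, if k ∈ J then (-1 : ℂ) else 0) = 0 := by
    intro J
    have h1 : Filter.Tendsto (fun t : ℝ => ∑ F ∈ S, c F *
        ((phi F (ι fun j => if j ∈ J then -t else t) : ℝ) : ℂ)) Filter.atTop
        (𝓝 (∑ F ∈ S, c F * ((∏ k ∈ F, if k ∈ J then (-1 : ℝ) else 0 : ℝ) : ℂ))) :=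
      tendsto_finsetSum _ fun F _ =>
        (Complex.continuous_ofReal.continuousAt.tendsto.comp (tendsto_phi F J a)).const_mul _
    simp only [hzero] at h1
    have h2 := tendsto_nhds_unique h1 tendsto_const_nhds
    refine Eq.trans (Finset.sum_congr rfl fun F _ => ?_) h2
    rw [Complex.ofReal_prod]
    congr 1
    refine Finset.prod_congr rfl fun k _ => ?_
    split_ifs <;> simp
  intro J
  induction J using Finset.strongInduction with
  | H J ih =>
    intro hJ
    have h1 := hrel J
    rw [Finset.sum_eq_single_of_mem J hJ] at h1
    · rw [Finset.prod_congr rfl fun k hk => if_pos hk, Finset.prod_const] at h1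
      exact (mul_eq_zero.1 h1).resolve_right (pow_ne_zero _ (by norm_num))
    · intro F hF hne
      by_cases hsub : F ⊆ J
      · rw [ih F (hsub.ssubset_of_ne hne) hF, zero_mul]
      · obtain ⟨k, hk, hkJ⟩ := Finset.not_subset.1 hsub
        rw [Finset.prod_eq_zero hk (if_neg hkJ), mul_zero]

end Real

/-! ### Polyhedra in general position -/

section Polyhedron

variable {d n : ℕ} {p : Var d n → ℝ}

theorem nerve_of_subset {J K : Finset (Fin n)} (hJ : J ∈ nerve p) (h : K ⊆ J) : K ∈ nerve p := by
  obtain ⟨x, hx, hxJ⟩ := hJ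
  exact ⟨x, hx, fun j hj => hxJ j (h hj)⟩

/-- The forms of the homogenization, as linear maps. -/
def homLin (p : Var d n → ℝ) (j : Fin (n + 1)) : (Fin (d + 1) → ℝ) →ₗ[ℝ] ℝ :=
  Fin.cases (LinearMap.proj 0)
    (fun k => p (Sum.inr k) • LinearMap.proj 0 +
      ∑ i, p (Sum.inl (i, k)) • LinearMap.proj (Fin.succ i)) j

theorem homLin_apply (j : Fin (n + 1)) (x : Fin (d + 1) → ℝ) : homLin p j x = homForm p j x := by
  refine Fin.cases ?_ (fun k => ?_) j
  · rfl
  · simp [homLin, homForm]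

theorem homLin_succ (k : Fin n) (x : Fin (d + 1) → ℝ) :
    homLin p k.succ x = p (Sum.inr k) * x 0 + ∑ i, p (Sum.inl (i, k)) * x (Fin.succ i) := by
  rw [homLin_apply]
  rfl

theorem exists_mem_homFace_forall_pos (J : Finset (Fin (n + 1)))
    (h : ∀ k ∉ J, ∃ y ∈ homFace p J, 0 < homForm p k y) :
    ∃ y ∈ homFace p J, ∀ k ∉ J, 0 < homForm p k y := by
  have h' : ∀ k, ∃ y ∈ homFace p J, k ∉ J → 0 < homForm p k y := by
    intro k
    by_cases hk : k ∈ J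
    · refine ⟨0, ⟨fun j _ => ?_, fun j => ?_⟩, fun h0 => absurd hk h0⟩ <;>
        simp [← homLin_apply]
    · obtain ⟨y, hy, hpos⟩ := h k hk
      exact ⟨y, hy, fun _ => hpos⟩
  choose y hy hpos using h'
  have hval : ∀ j, homForm p j (∑ k, y k) = ∑ k, homForm p j (y k) := by
    intro j
    simp only [← homLin_apply, map_sum]
  refine ⟨∑ k, y k, ⟨fun j hj => ?_, fun j => ?_⟩, fun k hk => ?_⟩
  · rw [hval]
    exact Finset.sum_eq_zero fun k _ => (hy k).1 j hj
  · rw [hval]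
    exact Finset.sum_nonneg fun k _ => (hy k).2 j
  · rw [hval]
    exact (hpos k hk).trans_le (Finset.single_le_sum (f := fun l => homForm p k (y l))
      (fun l _ => (hy l).2 k) (Finset.mem_univ k))

theorem surjective_homLin_of_mem_homFace (hgen : InGeneralPosition p) {J : Finset (Fin (n + 1))}
    {y : Fin (d + 1) → ℝ} (hy : y ∈ homFace p J) (hy0 : y ≠ 0) (c : J → ℝ) :
    ∃ v, ∀ j : J, homLin p j v = c j := by
  have hne : homFace p J ≠ {0} := fun h => hy0 (by simpa [h] using hy)
  have hdim : affDim (homFace p J) = (d : ℤ) + 1 - J.card := (hgen J).resolve_right hne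
  obtain ⟨y, hyJ, hpos⟩ := exists_mem_homFace_forall_pos (p := p) J fun k hk => by
    by_contra hcon
    push Not at hcon
    have heq : homFace p (insert k J) = homFace p J := by
      ext x
      constructor
      · exact fun hx => ⟨fun j hj => hx.1 j (Finset.mem_insert_of_mem hj), hx.2⟩
      · refine fun hx => ⟨fun j hj => ?_, hx.2⟩
        rcases Finset.mem_insert.1 hj with rfl | hj
        · exact le_antisymm (hcon x hx) (hx.2 _)
        · exact hx.1 j hj
    rcases hgen (insert k J) with h | h
    · rw [heq, hdim, Finset.card_insert_of_notMem hk] at h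
      push_cast at h
      omega
    · exact hne (heq ▸ h)
  set T : (Fin (d + 1) → ℝ) →ₗ[ℝ] (J → ℝ) := LinearMap.pi fun j => homLin p j with hT
  have hker : LinearMap.ker T ≤ (affineSpan ℝ (homFace p J)).direction := by
    intro v hv
    have hv' : ∀ j ∈ J, homLin p j v = 0 := fun j hj => congrFun (LinearMap.mem_ker.1 hv) ⟨j, hj⟩
    have hev : ∀ᶠ ε in 𝓝[>] (0 : ℝ), ∀ j, j ∉ J → 0 < homLin p j (y + ε • v) := by
      rw [Filter.eventually_all]
      intro j
      by_cases hj : j ∈ J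
      · exact Filter.Eventually.of_forall fun _ h => absurd hj h
      · have h1 : Filter.Tendsto (fun ε : ℝ => homLin p j (y + ε • v)) (𝓝[>] 0)
            (𝓝 (homLin p j y)) := by
          simp only [map_add, map_smul, smul_eq_mul]
          refine tendsto_nhdsWithin_of_tendsto_nhds ?_
          have : Continuous fun ε : ℝ => homLin p j y + ε * homLin p j v := by fun_prop
          simpa using this.tendsto 0
        have h2 : 0 < homLin p j y := by
          rw [homLin_apply]
          exact hpos j hj
        filter_upwards [h1.eventually (lt_mem_nhds h2)] with ε hε _
        exact hε
    obtain ⟨ε, hε, hε0⟩ := (hev.and self_mem_nhdsWithin).exists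
    have hε0' : ε ≠ 0 := ne_of_gt hε0
    have hmem : y + ε • v ∈ homFace p J := by
      have hz : ∀ j ∈ J, homForm p j (y + ε • v) = 0 := by
        intro j hj
        rw [← homLin_apply, map_add, map_smul, hv' j hj, homLin_apply, hyJ.1 j hj]
        simp
      refine ⟨hz, fun j => ?_⟩
      by_cases hj : j ∈ J
      · exact (hz j hj).ge
      · rw [← homLin_apply]
        exact (hε j hj).le
    have h3 := AffineSubspace.vsub_mem_direction (subset_affineSpan ℝ _ hmem)
      (subset_affineSpan ℝ _ hyJ)
    rw [vsub_eq_sub, add_sub_cancel_left] at h3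
    simpa [hε0'] using Submodule.smul_mem _ ε⁻¹ h3
  have hfin : (Module.finrank ℝ (affineSpan ℝ (homFace p J)).direction : ℤ) =
      (d : ℤ) + 1 - J.card := by
    rw [← hdim, affDim, if_neg (Set.Nonempty.ne_empty ⟨y, hyJ⟩)]
  have h1 := Submodule.finrank_mono hker
  have h2 := LinearMap.finrank_range_add_finrank_ker T
  rw [Module.finrank_fin_fun] at h2
  have h3 : LinearMap.range T = ⊤ := by
    apply Submodule.eq_top_of_finrank_eq
    have h4 := Submodule.finrank_le (LinearMap.range T)
    rw [Module.finrank_fintype_fun_eq_card, Fintype.card_coe] at h4 ⊢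
    omega
  obtain ⟨v, hv⟩ := LinearMap.range_eq_top.1 h3 c
  exact ⟨v, fun j => congrFun hv j⟩

theorem injective_colMap_of_mem_nerve (hgen : InGeneralPosition p) {F : Finset (Fin n)}
    (hF : F ∈ nerve p) : Function.Injective (colMap F p) := by
  obtain ⟨x, hx, hxF⟩ := hF
  have hform : ∀ k : Fin n, homForm p k.succ (Fin.cons 1 x) = affForm p k x := by
    intro k
    simp [homForm, affForm, add_comm]
  have hmem : (Fin.cons 1 x : Fin (d + 1) → ℝ) ∈ homFace p (F.map (Fin.succEmb n)) := by
    refine ⟨fun j hj => ?_, fun j => ?_⟩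
    · obtain ⟨k, hk, rfl⟩ := Finset.mem_map.1 hj
      exact (hform k).trans (hxF k hk).2
    · refine Fin.cases ?_ (fun k => ?_) j
      · simp [homForm]
      · rw [hform]
        exact hx k
  have hne : (Fin.cons 1 x : Fin (d + 1) → ℝ) ≠ 0 := fun h => by simpa using congrFun h 0
  rw [injective_iff_map_eq_zero]
  intro w hw
  have hw' : ∀ i, ∑ k : F, p (Sum.inl (i, k)) * w k = 0 := fun i => congrFun hw i
  obtain ⟨v, hv⟩ := surjective_homLin_of_mem_homFace hgen hmem hne fun j =>
    ∑ k : F, if Fin.succ k.1 = j.1 then w k else 0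
  have hvk : ∀ k : F, homLin p k.1.succ v = w k := by
    intro k
    rw [hv ⟨k.1.succ, Finset.mem_map_of_mem (Fin.succEmb n) k.2⟩]
    simp [Fin.succ_inj]
  have hb : ∑ k : F, w k * p (Sum.inr k) = 0 := by
    have h1 : ∑ k : F, w k * affForm p k x = 0 :=
      Finset.sum_eq_zero fun k _ => by rw [(hxF k k.2).2, mul_zero]
    simp only [affForm, mul_add, Finset.sum_add_distrib, Finset.mul_sum] at h1
    rw [Finset.sum_comm] at h1
    rw [Finset.sum_eq_zero fun i _ => ?_, zero_add] at h1
    · exact h1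
    · rw [← zero_mul (x i), ← hw' i, Finset.sum_mul]
      exact Finset.sum_congr rfl fun k _ => by ring
  have hsq : ∑ k : F, w k ^ 2 = 0 := by
    calc ∑ k : F, w k ^ 2 = ∑ k : F, w k * homLin p k.1.succ v :=
          Finset.sum_congr rfl fun k _ => by rw [hvk, sq]
      _ = (∑ k : F, w k * p (Sum.inr k)) * v 0 +
          ∑ i : Fin d, (∑ k : F, p (Sum.inl (i, k)) * w k) * v i.succ := by
          simp only [homLin_succ, mul_add, Finset.sum_add_distrib, Finset.mul_sum, Finset.sum_mul]
          congr 1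
          · exact Finset.sum_congr rfl fun k _ => by ring
          · rw [Finset.sum_comm]
            exact Finset.sum_congr rfl fun i _ => Finset.sum_congr rfl fun k _ => by ring
      _ = 0 := by
          rw [hb, zero_mul, zero_add]
          exact Finset.sum_eq_zero fun i _ => by rw [hw', zero_mul]
  ext k
  have := (Finset.sum_eq_zero_iff_of_nonneg fun k _ => sq_nonneg _).1 hsq k (Finset.mem_univ _)
  simpa using this

theorem linearIndependent_phi (hgen : InGeneralPosition p) {V : Set (Var d n → ℝ)}
    (hV : V ∈ 𝓝 p) :
    LinearIndependent ℂ (fun (F : nerve p) (q : V) => ((phi F.1 q.1 : ℝ) : ℂ)) := by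
  classical
  rw [linearIndependent_iff']
  intro s g hg F hF
  have h := coeff_eq_zero_of_eventually_sum_phi_eq_zero (q := p)
    (s.map (Function.Embedding.subtype _)) (fun J hJ => ?_)
    (fun J => if h : J ∈ nerve p then g ⟨J, h⟩ else 0) ?_ F.1 (by simpa using hF)
  · simpa using h
  · obtain ⟨K, -, rfl⟩ := Finset.mem_map.1 hJ
    exact injective_colMap_of_mem_nerve hgen K.2
  · filter_upwards [hV] with q hq
    have := congrFun hg ⟨q, hq⟩
    rw [Finset.sum_map]
    simpa using this

theorem sum_mul_add_affine_comb (c : Fin d → ℝ) (c₀ : ℝ) (x y : Fin d → ℝ) {s t : ℝ}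
    (h : s + t = 1) : ∑ i, c i * (s • x + t • y) i + c₀ =
      s * (∑ i, c i * x i + c₀) + t * (∑ i, c i * y i + c₀) := by
  have h1 : ∑ i, c i * (s • x + t • y) i = s * ∑ i, c i * x i + t * ∑ i, c i * y i := by
    rw [Finset.mul_sum, Finset.mul_sum, ← Finset.sum_add_distrib]
    refine Finset.sum_congr rfl fun i _ => ?_
    simp only [Pi.add_apply, Pi.smul_apply, smul_eq_mul]
    ring
  rw [h1]
  linear_combination (-c₀) * h

theorem affForm_affine_comb (j : Fin n) (x y : Fin d → ℝ) {s t : ℝ} (h : s + t = 1) :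
    affForm p j (s • x + t • y) = s * affForm p j x + t * affForm p j y :=
  sum_mul_add_affine_comb _ _ x y h

/-- Every nonempty face of a polyhedron is the intersection of the `F_j` that contain it. -/
theorem exists_nerve_of_isFace {F : Set (Fin d → ℝ)} (hF : IsFace (polyhedron p) F)
    (hne : F.Nonempty) :
    ∃ J ∈ nerve p, F = {x | x ∈ polyhedron p ∧ ∀ j ∈ J, x ∈ facetSet p j} := by
  classical
  obtain ⟨c, c₀, hc, rfl⟩ := hF
  set F := polyhedron p ∩ {x | ∑ i, c i * x i + c₀ = 0} with hF
  set J : Finset (Fin n) := Finset.univ.filter fun j => ∀ x ∈ F, affForm p j x = 0 with hJ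
  have hJF : ∀ x ∈ F, ∀ j ∈ J, affForm p j x = 0 := fun x hx j hj =>
    (Finset.mem_filter.1 hj).2 x hx
  have hint : ∀ S : Finset (Fin n), ∃ x ∈ F, ∀ j ∈ S, j ∉ J → 0 < affForm p j x := by
    intro S
    induction S using Finset.induction_on with
    | empty => exact ⟨hne.some, hne.some_mem, by simp⟩
    | insert k S _ ih =>
      obtain ⟨x, hx, hxS⟩ := ih
      by_cases hk : k ∈ J
      · refine ⟨x, hx, fun j hj hjJ => hxS j ?_ hjJ⟩
        exact (Finset.mem_insert.1 hj).resolve_left fun h => hjJ (h ▸ hk)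
      · obtain ⟨y, hy, hyk⟩ : ∃ y ∈ F, affForm p k y ≠ 0 := by
          by_contra hcon
          push Not at hcon
          exact hk (Finset.mem_filter.2 ⟨Finset.mem_univ _, hcon⟩)
        have hst : (1 / 2 : ℝ) + 1 / 2 = 1 := by norm_num
        refine ⟨(1 / 2 : ℝ) • x + (1 / 2 : ℝ) • y, ⟨fun j => ?_, ?_⟩, fun j hj hjJ => ?_⟩
        · rw [affForm_affine_comb j x y hst]
          have := hx.1 j
          have := hy.1 j
          positivity
        · change _ = _
          rw [sum_mul_add_affine_comb c c₀ x y hst, hx.2, hy.2]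
          norm_num
        · rw [affForm_affine_comb j x y hst]
          have h1 := hx.1 j
          have h2 := hy.1 j
          rcases Finset.mem_insert.1 hj with rfl | hj
          · have := lt_of_le_of_ne h2 (Ne.symm hyk)
            linarith
          · have := hxS j hj hjJ
            linarith
  obtain ⟨x, hx, hxpos⟩ := hint Finset.univ
  refine ⟨J, ⟨x, hx.1, fun j hj => ⟨hx.1, hJF x hx j hj⟩⟩, Set.Subset.antisymm
    (fun y hy => ⟨hy.1, fun j hj => ⟨hy.1, hJF y hy j hj⟩⟩) fun y hy => ⟨hy.1, ?_⟩⟩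
  have hev : ∀ᶠ ε in 𝓝[>] (0 : ℝ), ∀ j, j ∉ J →
      0 < (1 + ε) * affForm p j x + -ε * affForm p j y := by
    rw [Filter.eventually_all]
    intro j
    by_cases hj : j ∈ J
    · exact Filter.Eventually.of_forall fun _ h => absurd hj h
    · have h1 : Filter.Tendsto (fun ε : ℝ => (1 + ε) * affForm p j x + -ε * affForm p j y)
          (𝓝[>] 0) (𝓝 (affForm p j x)) := by
        refine tendsto_nhdsWithin_of_tendsto_nhds ?_
        have : Continuous fun ε : ℝ => (1 + ε) * affForm p j x + -ε * affForm p j y := by fun_prop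
        simpa using this.tendsto 0
      filter_upwards [h1.eventually (lt_mem_nhds (hxpos j (Finset.mem_univ j) hj))] with ε hε _
      exact hε
  obtain ⟨ε, hε, hε0⟩ := (hev.and self_mem_nhdsWithin).exists
  have hst : (1 + ε) + -ε = 1 := by ring
  have hmem : (1 + ε) • x + -ε • y ∈ polyhedron p := by
    intro j
    rw [affForm_affine_comb j x y hst]
    by_cases hj : j ∈ J
    · rw [hJF x hx j hj, (hy.2 j hj).2]
      simp
    · exact (hε j hj).le
  have h1 := hc _ hmem
  rw [sum_mul_add_affine_comb c c₀ x y hst, hx.2] at h1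
  have h2 := hc y hy.1
  have hε0' : 0 < ε := hε0
  change _ = (0 : ℝ)
  nlinarith

end Polyhedron

/-! ### Holomorphic solutions -/

section Solutions

variable {d n : ℕ}

/-- Evaluation of holomorphic functions at a point. -/
def Holo.evalAt {σ : Type} [Fintype σ] {Ω : TopologicalSpace.Opens (σ → ℂ)} (z : σ → ℂ) :
    Holo Ω →ₗ[ℂ] ℂ where
  toFun f := f.1 z
  map_add' _ _ := rfl
  map_smul' _ _ := rfl

theorem Holo.ext_evalAt {σ : Type} [Fintype σ] {Ω : TopologicalSpace.Opens (σ → ℂ)}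
    {f g : Holo Ω} (h : ∀ z ∈ Ω, Holo.evalAt z f = Holo.evalAt z g) : f = g :=
  Holo.ext_on h

theorem Holo.evalAt_X_smul {σ : Type} [Fintype σ] [DecidableEq σ]
    {Ω : TopologicalSpace.Opens (σ → ℂ)} (i : σ) (f : Holo Ω) (z : σ → ℂ) :
    Holo.evalAt z ((WeylAlgebra.X i : WeylAlgebra σ) • f) = z i * Holo.evalAt z f := by
  rw [Holo.X_smul]
  rfl

/-- The integral `expInt F ρ` as a holomorphic function on an open set where it converges. -/
def expHolo {F : Finset (Fin n)} (Ω : TopologicalSpace.Opens (Var d n → ℂ))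
    (hΩ : ∀ z ∈ Ω, gramMap z ∈ goodSet F) {ρ : EuclideanSpace ℝ F → ℂ} (hρ : Moderate ρ) :
    Holo Ω :=
  ⟨(Ω : Set (Var d n → ℂ)).indicator (expInt F ρ), by
    constructor
    · have h : AnalyticOnNhd ℂ (expInt F ρ) Ω := fun z hz => analyticAt_expInt hρ (hΩ z hz)
      refine h.congr Ω.isOpen fun z hz => ?_
      rw [Set.indicator_of_mem hz]
    · exact fun z hz => Set.indicator_of_notMem hz _⟩

variable {F : Finset (Fin n)} {Ω : TopologicalSpace.Opens (Var d n → ℂ)}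
  (hΩ : ∀ z ∈ Ω, gramMap z ∈ goodSet F) {ρ : EuclideanSpace ℝ F → ℂ} (hρ : Moderate ρ)

theorem evalAt_expHolo {z : Var d n → ℂ} (hz : z ∈ Ω) :
    Holo.evalAt z (expHolo Ω hΩ hρ) = expInt F ρ z :=
  Set.indicator_of_mem (s := (Ω : Set (Var d n → ℂ))) hz _

theorem expHolo_congr {ρ' : EuclideanSpace ℝ F → ℂ} (hρ' : Moderate ρ') (h : ∀ w, ρ w = ρ' w) :
    expHolo Ω hΩ hρ = expHolo Ω hΩ hρ' := by
  obtain rfl : ρ = ρ' := funext h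
  rfl

theorem expHolo_eq_zero (h : ∀ w, ρ w = 0) : expHolo Ω hΩ hρ = 0 := by
  refine Holo.ext_evalAt fun z hz => ?_
  rw [evalAt_expHolo hΩ hρ hz]
  simp [expInt, h]

theorem evalAt_D_smul_expHolo (v : Var d n) {z : Var d n → ℂ} (hz : z ∈ Ω) :
    Holo.evalAt z ((WeylAlgebra.D v : WeylAlgebra (Var d n)) • expHolo Ω hΩ hρ) =
      fderiv ℂ (expInt F ρ) z (Pi.single v 1) := by
  rw [Holo.D_smul]
  refine (Holo.pderiv_apply v _ hz).trans ?_
  have h : (expHolo Ω hΩ hρ).1 =ᶠ[𝓝 z] expInt F ρ := by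
    filter_upwards [Ω.isOpen.mem_nhds hz] with w hw
    exact evalAt_expHolo hΩ hρ hw
  rw [h.fderiv_eq]

theorem bDer_smul_expHolo (k : Fin n) :
    bDer d k • expHolo Ω hΩ hρ = expHolo Ω hΩ ((moderate_expVar F k).mul hρ) := by
  refine Holo.ext_evalAt fun z hz => ?_
  rw [bDer, evalAt_D_smul_expHolo hΩ hρ _ hz, fderiv_expInt_inr hρ (hΩ z hz), evalAt_expHolo _ _ hz]

theorem aDer_smul_expHolo (i : Fin d) (j : Fin n) :
    aDer i j • expHolo Ω hΩ hρ =
      ∑ k, (aVar i k * bDer d k * bDer d j) • expHolo Ω hΩ hρ := by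
  refine Holo.ext_evalAt fun z hz => ?_
  rw [aDer, evalAt_D_smul_expHolo hΩ hρ _ hz, fderiv_expInt_inl hρ (hΩ z hz), map_sum]
  refine Finset.sum_congr rfl fun k _ => ?_
  rw [mul_smul, mul_smul, bDer_smul_expHolo, bDer_smul_expHolo, aVar, Holo.evalAt_X_smul,
    evalAt_expHolo _ _ hz]

theorem moderate_prod_expVar (J : Finset (Fin n)) : Moderate fun w => ∏ k ∈ J, expVar F w k := by
  induction J using Finset.induction_on with
  | empty =>
    simpa using Moderate.of_bounded (F := F) (continuous_const (y := (1 : ℂ))) fun _ => le_rfl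
  | insert k S hk ih =>
    simp only [Finset.prod_insert hk]
    exact (moderate_expVar F k).mul ih

theorem bDerProd_smul_expHolo (J : Finset (Fin n)) :
    bDerProd d J • expHolo Ω hΩ hρ = expHolo Ω hΩ ((moderate_prod_expVar J).mul hρ) := by
  have h : ∀ l : List (Fin n), ∀ hl : Moderate fun w => (l.map (expVar F w)).prod * ρ w,
      (l.map fun j => bDer d j).prod • expHolo Ω hΩ hρ = expHolo Ω hΩ hl := by
    intro l
    induction l with
    | nil =>
      intro hl
      simp only [List.map_nil, List.prod_nil, one_smul]
      exact expHolo_congr hΩ hρ hl fun w => by simp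
    | cons j l ih =>
      intro hl
      have hl' : Moderate fun w => (l.map (expVar F w)).prod * ρ w := by
        clear ih hl
        induction l with
        | nil => simpa using hρ
        | cons i l ih => simpa [mul_assoc] using (moderate_expVar F i).mul ih
      rw [List.map_cons, List.prod_cons, mul_smul, ih hl', bDer_smul_expHolo]
      exact expHolo_congr hΩ _ _ fun w => by simp [mul_assoc]
  have hprod : ∀ w, ((J.sort (· ≤ ·)).map (expVar F w)).prod = ∏ k ∈ J, expVar F w k := by
    intro w
    rw [Finset.prod_eq_multiset_prod, ← Finset.sort_eq J (· ≤ ·), Multiset.map_coe,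
      Multiset.prod_coe]
  have hm : Moderate fun w => ((J.sort (· ≤ ·)).map (expVar F w)).prod * ρ w := by
    simpa only [hprod] using (moderate_prod_expVar J).mul hρ
  rw [bDerProd, h _ hm]
  exact expHolo_congr hΩ _ _ fun w => by rw [hprod]

/-- The weight of `∂_b^J Φ_F`. -/
def derivWeight (F J : Finset (Fin n)) (w : EuclideanSpace ℝ F) : ℂ :=
  (∏ k ∈ J, expVar F w k) * baseWeight F w

theorem moderate_derivWeight (F J : Finset (Fin n)) : Moderate (derivWeight F J) :=
  (moderate_prod_expVar J).mul (moderate_baseWeight F)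

theorem derivWeight_eq_zero {J : Finset (Fin n)} (h : ¬J ⊆ F) (w : EuclideanSpace ℝ F) :
    derivWeight F J w = 0 := by
  obtain ⟨k, hk, hkF⟩ := Finset.not_subset.1 h
  rw [derivWeight, Finset.prod_eq_zero hk (expVar_of_notMem hkF w), zero_mul]

theorem derivWeight_of_subset {J : Finset (Fin n)} (h : J ⊆ F) (w : EuclideanSpace ℝ F) :
    derivWeight F J w = ∏ k ∈ F \ J, (expVar F w k)⁻¹ := by
  rw [derivWeight, baseWeight, ← Finset.prod_sdiff h, mul_left_comm, ← Finset.prod_mul_distrib,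
    Finset.prod_congr rfl fun k hk => mul_inv_cancel₀ (expVar_ne_zero (h hk) w),
    Finset.prod_const_one, mul_one]

theorem derivWeight_add_smul_single {J : Finset (Fin n)} (h : J ⊆ F) {j : Fin n} (hj : j ∈ J)
    (w : EuclideanSpace ℝ F) (t : ℝ) :
    derivWeight F J (w + t • EuclideanSpace.single ⟨j, h hj⟩ 1) = derivWeight F J w := by
  rw [derivWeight_of_subset h, derivWeight_of_subset h]
  refine Finset.prod_congr rfl fun k hk => ?_
  obtain ⟨hkF, hkJ⟩ := Finset.mem_sdiff.1 hk
  have : k ≠ j := fun h => hkJ (h ▸ hj)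
  simp [expVar_of_mem hkF, this]

theorem bVar_add_smul_expHolo {J : Finset (Fin n)} {j : Fin n} (hj : j ∈ J) :
    (bVar j + ∑ k, ∑ i : Fin d, aVar i j * aVar i k * bDer d k) •
      expHolo Ω hΩ (moderate_derivWeight F J) = 0 := by
  by_cases h : J ⊆ F
  · refine Holo.ext_evalAt fun z hz => ?_
    have := expInt_integration_by_parts (moderate_derivWeight F J) (hΩ z hz) (h hj)
      (derivWeight_add_smul_single h hj)
    rw [map_zero, ← this, add_smul, map_add]
    congr 1
    · rw [bVar, Holo.evalAt_X_smul, evalAt_expHolo _ _ hz]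
    · rw [Finset.sum_smul, map_sum]
      refine Finset.sum_congr rfl fun k _ => ?_
      rw [Finset.sum_smul, map_sum]
      refine Finset.sum_congr rfl fun i _ => ?_
      rw [mul_smul, mul_smul, bDer_smul_expHolo, aVar, aVar, Holo.evalAt_X_smul,
        Holo.evalAt_X_smul, evalAt_expHolo _ _ hz, mul_assoc]
  · rw [expHolo_eq_zero hΩ _ (derivWeight_eq_zero h), smul_zero]

variable {p : Var d n → ℝ}

theorem gVec_of_mem {J : Finset (Fin n)} (h : J ∈ nerve p) :
    gVec p J = Finsupp.single ⟨J, h⟩ 1 := by simp [gVec, h]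

theorem gVec_of_notMem {J : Finset (Fin n)} (h : J ∉ nerve p) : gVec p J = 0 := by
  simp [gVec, h]

/-- The morphism from the free module that is given by the derivatives of `Φ_F`. -/
def solutionMap (p : Var d n → ℝ) :
    (nerve p →₀ WeylAlgebra (Var d n)) →ₗ[WeylAlgebra (Var d n)] Holo Ω :=
  Finsupp.linearCombination _ fun J : nerve p => expHolo Ω hΩ (moderate_derivWeight F J.1)

theorem solutionMap_gVec (hF : F ∈ nerve p) (J : Finset (Fin n)) :
    solutionMap hΩ p (gVec p J) = expHolo Ω hΩ (moderate_derivWeight F J) := by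
  by_cases h : J ∈ nerve p
  · simp [gVec_of_mem h, solutionMap]
  · rw [gVec_of_notMem h, map_zero, expHolo_eq_zero hΩ _ (derivWeight_eq_zero fun hJF =>
      h (nerve_of_subset hF hJF))]

theorem systemN_le_ker (hF : F ∈ nerve p) : systemN p ≤ LinearMap.ker (solutionMap hΩ p) := by
  rw [systemN, Submodule.span_le]
  rintro v ((⟨J, -, i, j, rfl⟩ | ⟨J, -, j, hj, rfl⟩) | ⟨J, -, j, hj, rfl⟩) <;>
    rw [SetLike.mem_coe, LinearMap.mem_ker]
  · rw [map_smul, solutionMap_gVec hΩ hF, sub_smul, aDer_smul_expHolo, Finset.sum_smul, sub_self]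
  · rw [map_sub, map_smul, solutionMap_gVec hΩ hF, solutionMap_gVec hΩ hF, bDer_smul_expHolo,
      sub_eq_zero]
    exact expHolo_congr hΩ _ _ fun w => by
      rw [derivWeight, derivWeight, Finset.prod_insert hj, mul_assoc]
  · rw [map_smul, solutionMap_gVec hΩ hF, bVar_add_smul_expHolo hΩ hj]

/-- The morphism of left modules from `M` that is given by the derivatives of `Φ_F`. -/
def solutionHom (hF : F ∈ nerve p) : SystemM p →ₗ[WeylAlgebra (Var d n)] Holo Ω :=
  (systemN p).liftQ (solutionMap hΩ p) (systemN_le_ker hΩ hF)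

theorem solutionHom_mk (hF : F ∈ nerve p) (J : Finset (Fin n)) :
    solutionHom hΩ hF ((systemN p).mkQ (gVec p J)) =
      expHolo Ω hΩ (moderate_derivWeight F J) :=
  ((systemN p).liftQ_apply _ _).trans (solutionMap_gVec hΩ hF J)

theorem isSolution_expHolo (hF : F ∈ nerve p) :
    IsSolution (systemN p) fun J : nerve p =>
      bDerProd d J.1 • expHolo Ω hΩ (moderate_baseWeight F) := by
  refine ⟨solutionHom hΩ hF, fun J => ?_⟩
  refine Eq.trans ?_ (bDerProd_smul_expHolo hΩ (moderate_baseWeight F) J.1).symm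
  rw [← gVec_of_mem J.2, solutionHom_mk]
  rfl

/-- The top derivative of `Φ_F` does not vanish identically. -/
theorem exists_expInt_derivWeight_self_ne_zero {q : Var d n → ℝ}
    (h : Function.Injective (colMap F q)) :
    ∃ b : Fin n → ℝ, expInt F (derivWeight F F)
      (fun v => ((Sum.elim (fun u => q (Sum.inl u)) b v : ℝ) : ℂ)) ≠ 0 := by
  set b : Fin n → ℝ := fun k => ∑ i : Fin d, (∑ l : F, q (Sum.inl (i, l))) * q (Sum.inl (i, k))
    with hb
  set q' : Var d n → ℝ := Sum.elim (fun u => q (Sum.inl u)) b with hq'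
  refine ⟨b, ?_⟩
  change expInt F (derivWeight F F) (fun v => (q' v : ℂ)) ≠ 0
  have hint := integrable_mul_cexp (moderate_derivWeight F F)
    ((gramMap_ofReal_mem_goodSet_iff F q').2 h)
  have him : ∀ w, ∑ k : F, q' (Sum.inr k) * w k -
      ∑ i, (∑ k : F, q' (Sum.inl (i, k))) * colMap F q' w i = 0 := by
    intro w
    simp only [hq', hb, Sum.elim_inr, Sum.elim_inl, colMap, LinearMap.coe_mk, AddHom.coe_mk]
    rw [sub_eq_zero]
    simp only [Finset.sum_mul _ _ (WithLp.ofLp w _), Finset.mul_sum (Finset.univ : Finset F)]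
    rw [Finset.sum_comm]
    exact Finset.sum_congr rfl fun i _ => Finset.sum_congr rfl fun k _ => by ring
  have hval : ∀ w, derivWeight F F w * Complex.exp (expForm F w (gramMap fun v => (q' v : ℂ))) =
      ((Real.exp (expForm F w (gramMap fun v => (q' v : ℂ))).re : ℝ) : ℂ) := by
    intro w
    rw [derivWeight_of_subset subset_rfl, Finset.sdiff_self, Finset.prod_empty, one_mul,
      expForm_gramMap_ofReal, him, mul_zero, Complex.ofReal_zero, zero_mul, add_zero,
      Complex.ofReal_re, Complex.ofReal_exp]
  simp only [hval] at hint
  rw [expInt]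
  simp only [hval]
  rw [integral_complex_ofReal]
  exact_mod_cast (integral_exp_pos hint.re).ne'

/-- A ball around the given matrix over which all the integrals converge. -/
theorem exists_ball_goodSet (hgen : InGeneralPosition p) :
    ∃ U : TopologicalSpace.Opens (Fin d × Fin n → ℂ),
      (fun q => ((p (Sum.inl q) : ℝ) : ℂ)) ∈ U ∧ IsConnected (U : Set (Fin d × Fin n → ℂ)) ∧
      ∀ F ∈ nerve p, ∀ z ∈ tube U, gramMap z ∈ goodSet F := by
  set e : (Fin d × Fin n → ℂ) → Var d n → ℂ := fun a => Sum.elim a 0 with he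
  have hcont : Continuous fun a => gramMap (e a) := by
    refine differentiable_gramMap.continuous.comp (continuous_pi ?_)
    rintro (v | v)
    · exact continuous_apply v
    · exact continuous_const
  have hopen : IsOpen (⋂ F ∈ nerve p, (fun a => gramMap (e a)) ⁻¹' goodSet F) :=
    (Set.toFinite (nerve p)).isOpen_biInter fun F _ => (isOpen_goodSet F).preimage hcont
  have hmem : (fun q => ((p (Sum.inl q) : ℝ) : ℂ)) ∈
      ⋂ F ∈ nerve p, (fun a => gramMap (e a)) ⁻¹' goodSet F := by
    refine Set.mem_iInter₂.2 fun F hF => ?_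
    exact goodSet_of_inl_eq ((gramMap_ofReal_mem_goodSet_iff F p).2
      (injective_colMap_of_mem_nerve hgen hF)) fun q => rfl
  obtain ⟨r, hr, hball⟩ := Metric.isOpen_iff.1 hopen _ hmem
  refine ⟨⟨Metric.ball _ r, Metric.isOpen_ball⟩, Metric.mem_ball_self hr,
    (convex_ball _ r).isConnected ⟨_, Metric.mem_ball_self hr⟩, fun F hF z hz => ?_⟩
  exact goodSet_of_inl_eq (Set.mem_iInter₂.1 (hball hz) F hF) fun q => rfl

theorem exists_holomorphic_solutions (hgen : InGeneralPosition p) :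
    ∃ U : TopologicalSpace.Opens (Fin d × Fin n → ℂ),
      (fun q => ((p (Sum.inl q) : ℝ) : ℂ)) ∈ U ∧ IsConnected (U : Set (Fin d × Fin n → ℂ)) ∧
      ∃ Φ : nerve p → Holo (tube U),
        (∀ (F : nerve p) (q : Var d n → ℝ), (fun v => ((q v : ℝ) : ℂ)) ∈ tube U →
          (Φ F).1 (fun v => ((q v : ℝ) : ℂ)) = ((phi F.1 q : ℝ) : ℂ)) ∧
        (∀ F : nerve p, IsSolution (systemN p) (fun J : nerve p => bDerProd d J.1 • Φ F)) ∧
        LinearIndependent ℂ Φ := by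
  obtain ⟨U, hpU, hconn, hgood⟩ := exists_ball_goodSet hgen
  have hval : ∀ (F : nerve p) (q : Var d n → ℝ), (fun v => ((q v : ℝ) : ℂ)) ∈ tube U →
      (expHolo (tube U) (hgood F.1 F.2) (moderate_baseWeight F.1)).1 (fun v => ((q v : ℝ) : ℂ)) =
        ((phi F.1 q : ℝ) : ℂ) := fun F q hq =>
    (evalAt_expHolo (hgood F.1 F.2) (moderate_baseWeight F.1) hq).trans (expInt_baseWeight_ofReal
      ((gramMap_ofReal_mem_goodSet_iff F.1 q).1 (hgood F.1 F.2 _ hq)))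
  refine ⟨U, hpU, hconn, fun F => expHolo (tube U) (hgood F.1 F.2) (moderate_baseWeight F.1),
    hval, fun F => isSolution_expHolo _ F.2, ?_⟩
  set V : Set (Var d n → ℝ) := ofRealVar d n ⁻¹' tube U with hV
  have hVp : V ∈ 𝓝 p := ((tube U).isOpen.preimage (ofRealVar d n).continuous).mem_nhds hpU
  refine LinearIndependent.of_comp (LinearMap.pi fun q : V => Holo.evalAt (ofRealVar d n q.1)) ?_
  convert linearIndependent_phi hgen hVp using 1
  · funext F q
    exact hval F q.1 q.2
  · rfl

end Solutions

/-! ### The holonomic rank -/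

namespace WeylAlgebra

variable {σ : Type}

theorem D_mul_X_of_ne {i j : σ} (h : i ≠ j) : (D i * X j : WeylAlgebra σ) = X j * D i := by
  have h := RingQuot.mkAlgHom_rel ℂ (WeylRel.dx_ne i j h)
  rw [map_mul, map_mul] at h
  exact h

theorem D_mul_X_self (i : σ) : (D i * X i : WeylAlgebra σ) = X i * D i + 1 := by
  have h := RingQuot.mkAlgHom_rel ℂ (WeylRel.dx_self i)
  rw [map_mul, map_add, map_mul, map_one] at h
  exact h

theorem D_mul_ofPoly (i : σ) (s : MvPolynomial σ ℂ) :
    D i * ofPoly σ s = ofPoly σ s * D i + ofPoly σ (MvPolynomial.pderiv i s) := by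
  classical
  induction s using MvPolynomial.induction_on with
  | C a =>
    rw [MvPolynomial.pderiv_C, map_zero, add_zero, ← MvPolynomial.algebraMap_eq, AlgHom.commutes]
    exact (Algebra.commutes a (D i)).symm
  | add s t hs ht =>
    rw [map_add, mul_add, hs, ht, map_add, map_add]
    noncomm_ring
  | mul_X s j hs =>
    rw [map_mul, ofPoly_X, ← mul_assoc, hs, Derivation.leibniz, MvPolynomial.pderiv_X, smul_eq_mul,
      smul_eq_mul, map_add, map_mul, map_mul, ofPoly_X, add_mul, mul_assoc]
    have hc : ofPoly σ (MvPolynomial.pderiv i s) * X j =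
        X j * ofPoly σ (MvPolynomial.pderiv i s) := by
      rw [← ofPoly_X, ← map_mul, ← map_mul, mul_comm]
    by_cases h : j = i
    · subst h
      rw [D_mul_X_self, Pi.single_eq_same, map_one, hc]
      noncomm_ring
    · rw [D_mul_X_of_ne (Ne.symm h), Pi.single_eq_of_ne h, map_zero, hc]
      noncomm_ring

theorem induction {motive : WeylAlgebra σ → Prop} (hC : ∀ a, motive (algebraMap ℂ _ a))
    (hX : ∀ i, motive (X i)) (hD : ∀ i, motive (D i))
    (hmul : ∀ a b, motive a → motive b → motive (a * b))
    (hadd : ∀ a b, motive a → motive b → motive (a + b)) (a : WeylAlgebra σ) : motive a := by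
  obtain ⟨x, rfl⟩ := RingQuot.mkAlgHom_surjective ℂ (WeylRel σ) a
  induction x using FreeAlgebra.induction with
  | grade0 r =>
    rw [AlgHom.commutes]
    exact hC r
  | grade1 x =>
    rcases x with i | i
    · exact hX i
    · exact hD i
  | mul x y hx hy =>
    rw [map_mul]
    exact hmul _ _ hx hy
  | add x y hx hy =>
    rw [map_add]
    exact hadd _ _ hx hy

variable {M : Type*} [AddCommGroup M] [Module (WeylAlgebra σ) M] [Module (MvPolynomial σ ℂ) M]

/-- The elements that have a nonzero polynomial multiple in a given submodule. -/
def saturation {R M : Type*} [CommRing R] [IsDomain R] [AddCommGroup M] [Module R M]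
    (N : Submodule R M) : Submodule R M where
  carrier := {m | ∃ s : R, s ≠ 0 ∧ s • m ∈ N}
  zero_mem' := ⟨1, one_ne_zero, by simp⟩
  add_mem' := by
    rintro a b ⟨s, hs, ha⟩ ⟨t, ht, hb⟩
    refine ⟨s * t, mul_ne_zero hs ht, ?_⟩
    rw [smul_add]
    refine N.add_mem ?_ ?_
    · rw [mul_comm, mul_smul]
      exact N.smul_mem t ha
    · rw [mul_smul]
      exact N.smul_mem s hb
  smul_mem' := by
    rintro c m ⟨s, hs, hm⟩
    refine ⟨s, hs, ?_⟩
    rw [smul_comm]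
    exact N.smul_mem c hm

theorem le_saturation {R M : Type*} [CommRing R] [IsDomain R] [AddCommGroup M] [Module R M]
    (N : Submodule R M) : N ≤ saturation N := fun m hm => ⟨1, one_ne_zero, by simpa⟩

theorem mem_saturation_of_smul_mem {R M : Type*} [CommRing R] [IsDomain R] [AddCommGroup M]
    [Module R M] {N : Submodule R M} {s : R} (hs : s ≠ 0) {m : M} (h : s • m ∈ saturation N) :
    m ∈ saturation N := by
  obtain ⟨t, ht, h⟩ := h
  exact ⟨t * s, mul_ne_zero ht hs, by rwa [mul_smul]⟩

theorem D_smul_mem_saturation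
    (hmod : ∀ (s : MvPolynomial σ ℂ) (m : M), s • m = ofPoly σ s • m) {ι : Type*} {g : ι → M}
    {i : σ} (h : ∀ J, (D i : WeylAlgebra σ) • g J ∈
      saturation (Submodule.span (MvPolynomial σ ℂ) (Set.range g))) {m : M}
    (hm : m ∈ saturation (Submodule.span (MvPolynomial σ ℂ) (Set.range g))) :
    (D i : WeylAlgebra σ) • m ∈ saturation (Submodule.span (MvPolynomial σ ℂ) (Set.range g)) := by
  have hcomm : ∀ (s : MvPolynomial σ ℂ) (m : M), (D i : WeylAlgebra σ) • s • m =
      s • (D i : WeylAlgebra σ) • m + MvPolynomial.pderiv i s • m := by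
    intro s m
    rw [hmod, hmod, hmod, ← mul_smul, D_mul_ofPoly, add_smul, mul_smul]
  have hspan : ∀ x ∈ Submodule.span (MvPolynomial σ ℂ) (Set.range g),
      (D i : WeylAlgebra σ) • x ∈
        saturation (Submodule.span (MvPolynomial σ ℂ) (Set.range g)) := by
    intro x hx
    induction hx using Submodule.span_induction with
    | mem x hx =>
      obtain ⟨J, rfl⟩ := hx
      exact h J
    | zero =>
      rw [smul_zero]
      exact Submodule.zero_mem _
    | add x y _ _ hx hy =>
      rw [smul_add]
      exact Submodule.add_mem _ hx hy
    | smul s x hx ih =>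
      rw [hcomm]
      exact Submodule.add_mem _ (Submodule.smul_mem _ _ ih)
        (Submodule.smul_mem _ _ (le_saturation _ hx))
  obtain ⟨s, hs, hsm⟩ := hm
  refine mem_saturation_of_smul_mem hs ?_
  rw [← add_sub_cancel_right (s • (D i : WeylAlgebra σ) • m) (MvPolynomial.pderiv i s • m),
    ← hcomm]
  exact Submodule.sub_mem _ (hspan _ hsm) (Submodule.smul_mem _ _ ⟨s, hs, hsm⟩)

/-- A family of generators that spans up to torsion a module stable under the derivations, and that
is linearly independent over the polynomials, bounds the holonomic rank from below. -/
theorem card_le_finrank_of_linearIndependent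
    (hmod : ∀ (s : MvPolynomial σ ℂ) (m : M), s • m = ofPoly σ s • m) {ι : Type*} [Fintype ι]
    {g : ι → M} (hgen : Submodule.span (WeylAlgebra σ) (Set.range g) = ⊤)
    (hder : ∀ i J, (D i : WeylAlgebra σ) • g J ∈
      saturation (Submodule.span (MvPolynomial σ ℂ) (Set.range g)))
    (hli : LinearIndependent (MvPolynomial σ ℂ) g) :
    Fintype.card ι ≤ Module.finrank (FractionRing (MvPolynomial σ ℂ))
      (FractionRing (MvPolynomial σ ℂ) ⊗[MvPolynomial σ ℂ] M) := by
  set R := MvPolynomial σ ℂ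
  set K := FractionRing R
  set S := saturation (Submodule.span R (Set.range g)) with hS
  have hstable : ∀ (a : WeylAlgebra σ), ∀ m ∈ S, a • m ∈ S := by
    intro a
    induction a using WeylAlgebra.induction with
    | hC a =>
      intro m hm
      rw [← AlgHom.commutes (ofPoly σ), ← hmod]
      exact S.smul_mem _ hm
    | hX i =>
      intro m hm
      rw [← ofPoly_X, ← hmod]
      exact S.smul_mem _ hm
    | hD i => exact fun m hm => D_smul_mem_saturation hmod (hder i) hm
    | hmul a b ha hb =>
      intro m hm
      rw [mul_smul]
      exact ha _ (hb _ hm)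
    | hadd a b ha hb =>
      intro m hm
      rw [add_smul]
      exact S.add_mem (ha _ hm) (hb _ hm)
  have htop : ∀ m : M, m ∈ S := by
    intro m
    have hm : m ∈ Submodule.span (WeylAlgebra σ) (Set.range g) := hgen ▸ Submodule.mem_top
    induction hm using Submodule.span_induction with
    | mem x hx => exact le_saturation _ (Submodule.subset_span hx)
    | zero => exact S.zero_mem
    | add x y _ _ hx hy => exact S.add_mem hx hy
    | smul a x _ hx => exact hstable a x hx
  have hli' : LinearIndependent K (TensorProduct.mk R K M 1 ∘ g) :=
    hli.of_isLocalizedModule K (nonZeroDivisors R) _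
  have hspan : Submodule.span K (Set.range (TensorProduct.mk R K M 1 ∘ g)) = ⊤ := by
    rw [eq_top_iff]
    rintro x -
    induction x using TensorProduct.induction_on with
    | zero => exact Submodule.zero_mem _
    | add x y hx hy => exact Submodule.add_mem _ hx hy
    | tmul q m =>
      obtain ⟨s, hs, hsm⟩ := htop m
      have h1 : ∀ y ∈ Submodule.span R (Set.range g), (1 : K) ⊗ₜ[R] y ∈
          Submodule.span K (Set.range (TensorProduct.mk R K M 1 ∘ g)) := by
        intro y hy
        induction hy using Submodule.span_induction with
        | mem x hx =>
          obtain ⟨J, rfl⟩ := hx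
          exact Submodule.subset_span ⟨J, rfl⟩
        | zero =>
          rw [TensorProduct.tmul_zero]
          exact Submodule.zero_mem _
        | add x y _ _ hx hy =>
          rw [TensorProduct.tmul_add]
          exact Submodule.add_mem _ hx hy
        | smul r x _ hx =>
          rw [TensorProduct.tmul_smul, ← algebraMap_smul K r]
          exact Submodule.smul_mem _ _ hx
      have hs' : algebraMap R K s ≠ 0 :=
        (map_ne_zero_iff _ (IsFractionRing.injective R K)).2 hs
      have h2 : q ⊗ₜ[R] m = (q * (algebraMap R K s)⁻¹) • ((1 : K) ⊗ₜ[R] (s • m)) := by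
        rw [TensorProduct.tmul_smul, ← algebraMap_smul K s, smul_smul, mul_assoc,
          inv_mul_cancel₀ hs', mul_one, TensorProduct.smul_tmul', smul_eq_mul, mul_one]
      rw [h2]
      exact Submodule.smul_mem _ _ (h1 _ hsm)
  classical
  have : Module.Finite K (K ⊗[R] M) := ⟨⟨Finset.univ.image (TensorProduct.mk R K M 1 ∘ g), by
    rw [Finset.coe_image, Finset.coe_univ, Set.image_univ, hspan]⟩⟩
  exact hli'.fintype_card_le_finrank

end WeylAlgebra

theorem Holo.evalAt_ofPoly_smul {σ : Type} [Fintype σ] [DecidableEq σ]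
    {Ω : TopologicalSpace.Opens (σ → ℂ)} (s : MvPolynomial σ ℂ) (f : Holo Ω) (z : σ → ℂ) :
    Holo.evalAt z (WeylAlgebra.ofPoly σ s • f) = MvPolynomial.eval z s * Holo.evalAt z f := by
  induction s using MvPolynomial.induction_on generalizing f with
  | C a =>
    rw [← MvPolynomial.algebraMap_eq, AlgHom.commutes, MvPolynomial.algebraMap_eq,
      MvPolynomial.eval_C]
    change Holo.evalAt z (Holo.action Ω (algebraMap ℂ _ a) f) = _
    rw [AlgHom.commutes, Module.algebraMap_end_apply, map_smul, smul_eq_mul]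
  | add s t hs ht => rw [map_add, add_smul, map_add, hs, ht, map_add, add_mul]
  | mul_X s i hs =>
    rw [map_mul, mul_smul, hs, WeylAlgebra.ofPoly_X, Holo.evalAt_X_smul, map_mul,
      MvPolynomial.eval_X, mul_assoc]

theorem MvPolynomial.eq_zero_of_eventually_eval_eq_zero {σ : Type} [Fintype σ]
    {s : MvPolynomial σ ℂ} {z : σ → ℂ} (h : ∀ᶠ x in 𝓝 z, MvPolynomial.eval x s = 0) : s = 0 := by
  obtain ⟨ε, hε, hball⟩ := Metric.eventually_nhds_iff_ball.1 h
  refine MvPolynomial.funext_set (fun i => Metric.ball (z i) ε) (fun i => ?_) fun x hx => ?_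
  · exact infinite_of_mem_nhds (z i) (Metric.ball_mem_nhds _ hε)
  · rw [map_zero]
    refine hball x ?_
    rw [Metric.mem_ball, dist_pi_lt_iff hε]
    exact fun i => hx i trivial

section Rank

variable {d n : ℕ} {p : Var d n → ℝ}

/-- The class of `g^J` in `M`. -/
def gClass (p : Var d n → ℝ) (J : Finset (Fin n)) : SystemM p := (systemN p).mkQ (gVec p J)

theorem gClass_of_notMem {J : Finset (Fin n)} (h : J ∉ nerve p) : gClass p J = 0 := by
  rw [gClass, gVec_of_notMem h, map_zero]

theorem aDer_smul_gClass {J : Finset (Fin n)} (hJ : J ∈ nerve p) (i : Fin d) (j : Fin n) :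
    aDer i j • gClass p J = ∑ k : Fin n, aVar i k • bDer d k • bDer d j • gClass p J := by
  have h : (systemN p).mkQ ((aDer i j - ∑ k, aVar i k * bDer d k * bDer d j) • gVec p J) = 0 :=
    (Submodule.Quotient.mk_eq_zero _).2
      (Submodule.subset_span (Or.inl (Or.inl ⟨J, hJ, i, j, rfl⟩)))
  rw [map_smul, sub_smul, Finset.sum_smul, sub_eq_zero] at h
  simp only [mul_smul] at h
  exact h

theorem bDer_smul_gClass {J : Finset (Fin n)} (hJ : J ∈ nerve p) {j : Fin n} (hj : j ∉ J) :
    bDer d j • gClass p J = gClass p (insert j J) := by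
  have h : (systemN p).mkQ (bDer d j • gVec p J - gVec p (insert j J)) = 0 :=
    (Submodule.Quotient.mk_eq_zero _).2
      (Submodule.subset_span (Or.inl (Or.inr ⟨J, hJ, j, hj, rfl⟩)))
  rwa [map_sub, map_smul, sub_eq_zero] at h

theorem bVar_smul_gClass {J : Finset (Fin n)} (hJ : J ∈ nerve p) {j : Fin n} (hj : j ∈ J) :
    (bVar j : WeylAlgebra (Var d n)) • gClass p J + ∑ k : Fin n, ∑ i : Fin d,
      (aVar i j * aVar i k) • bDer d k • gClass p J = 0 := by
  have h : (systemN p).mkQ ((bVar j + ∑ k, ∑ i : Fin d, aVar i j * aVar i k * bDer d k) •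
      gVec p J) = 0 :=
    (Submodule.Quotient.mk_eq_zero _).2
      (Submodule.subset_span (Or.inr ⟨J, hJ, j, hj, rfl⟩))
  rw [map_smul, add_smul, Finset.sum_smul] at h
  simp only [Finset.sum_smul, mul_smul] at h ⊢
  exact h

/-- The entries of the Gram matrix, as polynomials. -/
def gramPoly (d : ℕ) {n : ℕ} (j k : Fin n) : MvPolynomial (Var d n) ℂ :=
  ∑ i : Fin d, MvPolynomial.X (Sum.inl (i, j)) * MvPolynomial.X (Sum.inl (i, k))

theorem ofPoly_gramPoly (j k : Fin n) : WeylAlgebra.ofPoly (Var d n) (gramPoly d j k) =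
    ∑ i : Fin d, aVar i j * aVar i k := by
  simp [gramPoly, map_sum, WeylAlgebra.ofPoly_X, aVar]

/-- The Gram matrix with polynomial entries. -/
def gramPolyMatrix (d : ℕ) {n : ℕ} (F : Finset (Fin n)) :
    Matrix F F (MvPolynomial (Var d n) ℂ) := Matrix.of fun j k => gramPoly d j.1 k.1

theorem det_gramPolyMatrix_ne_zero (hgen : InGeneralPosition p) {F : Finset (Fin n)}
    (hF : F ∈ nerve p) : (gramPolyMatrix d F).det ≠ 0 := by
  intro h
  have h1 := congrArg (MvPolynomial.eval fun v => (p v : ℂ)) h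
  rw [RingHom.map_det, map_zero] at h1
  have h2 : (MvPolynomial.eval fun v => (p v : ℂ)).mapMatrix (gramPolyMatrix d F) =
      Complex.ofRealHom.mapMatrix (gramMatrix F p) := by
    ext j k
    simp [gramPolyMatrix, gramPoly, gramMatrix]
  rw [h2, ← RingHom.map_det] at h1
  refine (det_gramMatrix_ne_zero_iff F p).2 (injective_colMap_of_mem_nerve hgen hF) ?_
  simpa using h1

theorem span_gClass_eq_top :
    Submodule.span (WeylAlgebra (Var d n)) (Set.range fun J : nerve p => gClass p J.1) = ⊤ := by
  have h : (Set.range fun J : nerve p => gClass p J.1) =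
      (systemN p).mkQ '' Set.range fun J : nerve p =>
        (Finsupp.single J 1 : nerve p →₀ WeylAlgebra (Var d n)) := by
    rw [← Set.range_comp]
    congr 1
    funext J
    rw [Function.comp_apply, gClass, gVec_of_mem J.2]
  have h1 := (Finsupp.basisSingleOne (R := WeylAlgebra (Var d n)) (ι := nerve p)).span_eq
  rw [Finsupp.coe_basisSingleOne] at h1
  rw [h, Submodule.span_image, h1, Submodule.map_top, Submodule.range_mkQ]

variable [Module (MvPolynomial (Var d n) ℂ) (SystemM p)]

/-- The polynomial span of the classes `g^J`. -/
def gSpan (p : Var d n → ℝ) [Module (MvPolynomial (Var d n) ℂ) (SystemM p)] :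
    Submodule (MvPolynomial (Var d n) ℂ) (SystemM p) :=
  Submodule.span (MvPolynomial (Var d n) ℂ) (Set.range fun J : nerve p => gClass p J.1)

theorem gClass_mem_gSpan (J : Finset (Fin n)) : gClass p J ∈ gSpan p := by
  by_cases h : J ∈ nerve p
  · exact Submodule.subset_span ⟨⟨J, h⟩, rfl⟩
  · rw [gClass_of_notMem h]
    exact Submodule.zero_mem _

theorem bDer_smul_gClass_mem
    (hmod : ∀ (s : MvPolynomial (Var d n) ℂ) (m : SystemM p),
      s • m = WeylAlgebra.ofPoly (Var d n) s • m)
    (hgen : InGeneralPosition p) {J : Finset (Fin n)} (hJ : J ∈ nerve p)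
    (k : Fin n) : bDer d k • gClass p J ∈ WeylAlgebra.saturation (gSpan p) := by
  by_cases hk : k ∈ J
  · set v : J → SystemM p := fun l => bDer d l.1 • gClass p J with hv
    set A := gramPolyMatrix d J with hA
    have hA' : ∀ j : J, ∑ l, A j l • v l ∈ gSpan p := by
      intro j
      have h1 := bVar_smul_gClass hJ j.2
      have h2 : ∀ l, ∑ i : Fin d, (aVar i j.1 * aVar i l) • bDer d l • gClass p J =
          gramPoly d j.1 l • bDer d l • gClass p J := by
        intro l
        rw [hmod, ofPoly_gramPoly, Finset.sum_smul]
      simp only [h2] at h1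
      rw [← Finset.sum_add_sum_compl J, ← Finset.sum_coe_sort J, add_left_comm] at h1
      have h3 : ∑ l, A j l • v l = -((bVar j.1 : WeylAlgebra (Var d n)) • gClass p J +
          ∑ l ∈ Jᶜ, gramPoly d j.1 l • bDer d l • gClass p J) := eq_neg_of_add_eq_zero_left h1
      rw [h3]
      refine Submodule.neg_mem _ (Submodule.add_mem _ ?_ (Submodule.sum_mem _ fun l hl => ?_))
      · rw [bVar, ← WeylAlgebra.ofPoly_X, ← hmod]
        exact Submodule.smul_mem _ _ (gClass_mem_gSpan J)
      · rw [bDer_smul_gClass hJ (Finset.mem_compl.1 hl)]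
        exact Submodule.smul_mem _ _ (gClass_mem_gSpan _)
    refine ⟨A.det, det_gramPolyMatrix_ne_zero hgen hJ, ?_⟩
    have h4 : A.det • bDer d k • gClass p J =
        ∑ j, A.adjugate ⟨k, hk⟩ j • ∑ l, A j l • v l := by
      simp only [Finset.smul_sum, smul_smul]
      rw [Finset.sum_comm]
      simp only [← Finset.sum_smul, ← Matrix.mul_apply, Matrix.adjugate_mul, Matrix.smul_apply,
        Matrix.one_apply, smul_eq_mul]
      rw [Finset.sum_eq_single ⟨k, hk⟩]
      · simp [hv]
      · intro l _ hl
        simp [Ne.symm hl]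
      · simp
    rw [h4]
    exact Submodule.sum_mem _ fun j _ => Submodule.smul_mem _ _ (hA' j)
  · rw [bDer_smul_gClass hJ hk]
    exact WeylAlgebra.le_saturation _ (gClass_mem_gSpan _)

theorem D_smul_gClass_mem
    (hmod : ∀ (s : MvPolynomial (Var d n) ℂ) (m : SystemM p),
      s • m = WeylAlgebra.ofPoly (Var d n) s • m)
    (hgen : InGeneralPosition p) {J : Finset (Fin n)} (hJ : J ∈ nerve p)
    (v : Var d n) : (WeylAlgebra.D v : WeylAlgebra (Var d n)) • gClass p J ∈
      WeylAlgebra.saturation (gSpan p) := by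
  rcases v with ⟨i, j⟩ | k
  · change aDer i j • gClass p J ∈ _
    rw [aDer_smul_gClass hJ]
    refine Submodule.sum_mem _ fun k _ => ?_
    rw [aVar, ← WeylAlgebra.ofPoly_X, ← hmod]
    exact Submodule.smul_mem _ _ (WeylAlgebra.D_smul_mem_saturation hmod
      (fun K => bDer_smul_gClass_mem hmod hgen K.2 k) (bDer_smul_gClass_mem hmod hgen hJ j))
  · exact bDer_smul_gClass_mem hmod hgen hJ k

theorem linearIndependent_gClass
    (hmod : ∀ (s : MvPolynomial (Var d n) ℂ) (m : SystemM p),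
      s • m = WeylAlgebra.ofPoly (Var d n) s • m)
    (hgen : InGeneralPosition p) :
    LinearIndependent (MvPolynomial (Var d n) ℂ) fun J : nerve p => gClass p J.1 := by
  classical
  have : Fintype (nerve p) := Fintype.ofFinite _
  rw [Fintype.linearIndependent_iff]
  intro Q hQ
  obtain ⟨U, hpU, -, hgood⟩ := exists_ball_goodSet hgen
  have hrel : ∀ F : nerve p, ∀ z ∈ tube U,
      ∑ J, MvPolynomial.eval z (Q J) * expInt F.1 (derivWeight F.1 J.1) z = 0 := by
    intro F z hz
    have h1 := congrArg (fun m => Holo.evalAt z (solutionHom (hgood F.1 F.2) F.2 m)) hQ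
    simp only [map_sum, map_zero] at h1
    rw [← h1]
    refine Finset.sum_congr rfl fun J _ => ?_
    rw [hmod, map_smul, Holo.evalAt_ofPoly_smul, gClass, solutionHom_mk, evalAt_expHolo _ _ hz]
  have main : ∀ (F : Finset (Fin n)) (hF : F ∈ nerve p), Q ⟨F, hF⟩ = 0 := by
    intro F
    induction F using Finset.strongInduction with
    | H F ih =>
      intro hF
      obtain ⟨b, hb⟩ := exists_expInt_derivWeight_self_ne_zero
        (injective_colMap_of_mem_nerve hgen hF)
      set z : Var d n → ℂ :=
        fun v => ((Sum.elim (fun u => p (Sum.inl u)) b v : ℝ) : ℂ) with hz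
      have hzU : z ∈ tube U := hpU
      refine MvPolynomial.eq_zero_of_eventually_eval_eq_zero (z := z) ?_
      have hc := (analyticAt_expInt (moderate_derivWeight F F)
        (hgood F hF z hzU)).continuousAt.eventually_ne hb
      filter_upwards [hc, (tube U).isOpen.mem_nhds hzU] with x hx hxU
      have h1 := hrel ⟨F, hF⟩ x hxU
      rw [Finset.sum_eq_single_of_mem ⟨F, hF⟩ (Finset.mem_univ _)] at h1
      · exact (mul_eq_zero.1 h1).resolve_right hx
      · rintro ⟨J, hJ⟩ - hne
        by_cases hsub : J ⊆ F
        · rw [ih J (hsub.ssubset_of_ne fun h => hne (Subtype.ext h)) hJ, map_zero, zero_mul]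
        · have h0 : expInt F (derivWeight F J) x = 0 := by
            simp [expInt, derivWeight_eq_zero hsub]
          exact mul_eq_zero_of_right _ h0
  exact fun J => main J.1 J.2

end Rank

theorem encard_nerve_le_holonomicRank {d n : ℕ} {p : Var d n → ℝ} (hgen : InGeneralPosition p) :
    (nerve p).encard ≤ (WeylAlgebra.holonomicRank (Var d n) (SystemM p) : ℕ∞) := by
  have : Fintype (nerve p) := Fintype.ofFinite _
  rw [← Set.coe_fintypeCard]
  unfold WeylAlgebra.holonomicRank
  let : Module (MvPolynomial (Var d n) ℂ) (SystemM p) :=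
    Module.compHom _ (WeylAlgebra.ofPoly (Var d n)).toRingHom
  have hmod : ∀ (s : MvPolynomial (Var d n) ℂ) (m : SystemM p),
    s • m = WeylAlgebra.ofPoly (Var d n) s • m := fun _ _ => rfl
  exact_mod_cast WeylAlgebra.card_le_finrank_of_linearIndependent hmod
    span_gClass_eq_top (fun v J => D_smul_gClass_mem hmod hgen J.2 v)
    (linearIndependent_gClass hmod hgen)

theorem encard_faces_le_encard_nerve {d n : ℕ} (p : Var d n → ℝ) :
    {F | IsFace (polyhedron p) F ∧ F.Nonempty}.encard ≤ (nerve p).encard := by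
  refine le_trans (Set.encard_le_encard ?_) (Set.encard_image_le
    (fun J => {x | x ∈ polyhedron p ∧ ∀ j ∈ J, x ∈ facetSet p j}) (nerve p))
  rintro F ⟨hF, hne⟩
  obtain ⟨J, hJ, rfl⟩ := exists_nerve_of_isFace hF hne
  exact ⟨J, hJ, rfl⟩

end

theorem mainTheorem7 (d n : ℕ) (hd : 0 < d) (hn : 0 < n) (p : Var d n → ℝ)
    (hbound : IsBoundingFamily p) (hgen : InGeneralPosition p) :
    -- the functions `φ_F` are real analytic, on an open set that contains the given `(a, b)`
    (∀ F ∈ nerve p, (gramMatrix F p).det ≠ 0 ∧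
      AnalyticOnNhd ℝ (phi F) {q : Var d n → ℝ | (gramMatrix F q).det ≠ 0}) ∧
    -- they are linearly independent over `ℂ` on every neighbourhood of the given `(a, b)`
    (∀ V ∈ 𝓝 p, LinearIndependent ℂ (fun (F : nerve p) (q : V) => ((phi F.1 q.1 : ℝ) : ℂ))) ∧
    -- they extend to linearly independent holomorphic solutions of `M` on a complex domain
    (∃ U : TopologicalSpace.Opens (Fin d × Fin n → ℂ),
      (fun q => ((p (Sum.inl q) : ℝ) : ℂ)) ∈ U ∧ IsConnected (U : Set (Fin d × Fin n → ℂ)) ∧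
      ∃ Φ : nerve p → Holo (tube U),
        (∀ (F : nerve p) (q : Var d n → ℝ), (fun v => ((q v : ℝ) : ℂ)) ∈ tube U →
          (Φ F).1 (fun v => ((q v : ℝ) : ℂ)) = ((phi F.1 q : ℝ) : ℂ)) ∧
        (∀ F : nerve p, IsSolution (systemN p) (fun J : nerve p => bDerProd d J.1 • Φ F)) ∧
        LinearIndependent ℂ Φ) ∧
    -- the holonomic rank of `M` is at least the number of nonempty faces of the polyhedron
    {F | IsFace (polyhedron p) F ∧ F.Nonempty}.encard ≤
      (WeylAlgebra.holonomicRank (Var d n) (SystemM p) : ℕ∞) := by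
  refine ⟨fun F hF => ⟨(det_gramMatrix_ne_zero_iff F p).2 (injective_colMap_of_mem_nerve hgen hF),
    fun q hq => analyticAt_phi ((det_gramMatrix_ne_zero_iff F q).1 hq)⟩,
    fun V hV => linearIndependent_phi hgen hV, exists_holomorphic_solutions hgen,
    (encard_faces_le_encard_nerve p).trans (encard_nerve_le_holonomicRank hgen)⟩
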